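/- Let $n\ge 2$ and $r\ge 1$ be integers and $\mathbf{x}=\{x_1,\dots,x_r\}$. Let $\Omega=\{\lambda,\alpha_1,\dots,\alpha_n\}$, where $\lambda$ is $n$-ary and each $\alpha_i$ is unary (operators are written on the right), and let $V_{n,r}$ be the quotient of the algebra of $\Omega$-words in $\mathbf{x}$ by the fully invariant congruence generated by the laws $w\alpha_1\cdots w\alpha_n\lambda=w$ and $w_1\cdots w_n\lambda\alpha_i=w_i$ ($1\le i\le n$); it is the free algebra on $\mathbf{x}$ in the variety defined by these laws. Let $G_{n,r}$ be the group of $\Omega$-algebra automorphisms of $V_{n,r}$. A simple expansion of a subset $Y$ of $V_{n,r}$ replaces some $y\in Y$ by $y\alpha_1,\dots,y\alpha_n$; a simple contraction replaces $n$ distinct elements $y_1,\dots,y_n$ of $Y$ by $y_1\cdots y_n\lambda$. An expansion (contraction) of $Y$ is a set obtained from $Y$ by finitely many, possibly zero, simple expansions (contractions); a contraction is proper if it is different from $Y$. An $A$-basis is an expansion of $\mathbf{x}$. For $Y\subseteq V_{n,r}$ put $Y\langle A\rangle=\{y\alpha_{i_1}\cdots\alpha_{i_k} : y\in Y,\ k\ge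 0,\ 1\le i_j\le n\}$. Let $\psi\in G_{n,r}$ and let $X$ be an $A$-basis. An $X$-component of $\psi$ is a maximal non-empty subsequence $\mathcal{C}$ of a sequence $(y\psi^i)_{i\in\mathbb{Z}}$, $y\in V_{n,r}$, such that $y\psi^k\in X\langle A\rangle$ whenever $p\le k\le q$ and the $p$-th and $q$-th terms of the sequence belong to $\mathcal{C}$. It is incomplete finite if, for some member $z$ of $\mathcal{C}$ and some $m\ge 0$, the elements $z,z\psi,\dots,z\psi^m$ lie in $X\langle A\rangle$ but $z\psi^{-1}$ and $z\psi^{m+1}$ do not. The automorphism $\psi$ is in semi-normal form with respect to $X$ if no element of $X\langle A\rangle$ is in an incomplete finite $X$-component of $\psi$. It is in quasi-normal form with respect to $X$ if it is in semi-normal form with respect to $X$, but not with respect to any $A$-basis that is a proper contraction of $X$. Then for every $\psi\in G_{n,r}$ there is a unique $A$-basis $X_\psi$ with respect to which $\psi$ is in quasi-normal form. Furthermore $X_\psi$ can be effectively constructed: there is an algorithm (a partial recursive function, the same for all $n\ge 2$ and $r\ge 1$) which, given $n$, $r$ and a finite list of pairs of $\Omega$-words $(u_1,v_1),\dots,(u_s,v_s)$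 such that the elements of $V_{n,r}$ represented by $u_1,\dots,u_s$ form a basis (free generating set) of $V_{n,r}$ and $\psi$ maps the element represented by $u_j$ to the one represented by $v_j$ for each $j$, halts and outputs a list without repetitions of words of the form $x_i\alpha_{i_1}\cdots\alpha_{i_k}$ representing exactly the elements of $X_\psi$. -/

import Mathlib

namespace Higman

/-- An algebra in the variety of Higman: a set with `n` unary descending operations and one
`n`-ary contraction, satisfying the laws `w α₁ ⋯ w αₙ λ = w` and `w₁ ⋯ wₙ λ αᵢ = wᵢ`. -/
class HigmanAlgebra (n : ℕ) (S : Type*) where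
  /-- the descending operations -/
  alpha : Fin n → S → S
  /-- the contraction -/
  lam : (Fin n → S) → S
  lam_alpha : ∀ w : S, lam (fun i => alpha i w) = w
  alpha_lam : ∀ (w : Fin n → S) (i : Fin n), alpha i (lam w) = w i

open HigmanAlgebra

/-- Homomorphisms of algebras with the operations `αᵢ` and `λ`. -/
def IsHom (n : ℕ) {S T : Type*} [HigmanAlgebra n S] [HigmanAlgebra n T] (h : S → T) : Prop :=
  (∀ (i : Fin n) (v : S), h (alpha i v) = alpha i (h v)) ∧
    ∀ w : Fin n → S, h (lam w) = lam (fun i => h (w i))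

/-- The `Ω`-words in the alphabet `x₁, …, xᵣ`, where `Ω = {λ, α₁, …, αₙ}`. -/
inductive Word (n r : ℕ) : Type
  | gen (i : Fin r) : Word n r
  | alpha (j : Fin n) (w : Word n r) : Word n r
  | lam (w : Fin n → Word n r) : Word n r

/-- The congruence on the word algebra generated by the two laws. The set of pairs given by the
laws is closed under endomorphisms, so this is also the fully invariant congruence they generate. -/
inductive Cong (n r : ℕ) : Word n r → Word n r → Prop
  | refl (w : Word n r) : Cong n r w w
  | symm {u v : Word n r} : Cong n r u v → Cong n r v u
  | trans {u v w : Word n r} : Cong n r u v → Cong n r v w → Cong n r u w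
  | alpha_congr (j : Fin n) {u v : Word n r} :
      Cong n r u v → Cong n r (Word.alpha j u) (Word.alpha j v)
  | lam_congr {u v : Fin n → Word n r} :
      (∀ i, Cong n r (u i) (v i)) → Cong n r (Word.lam u) (Word.lam v)
  | lam_alpha (w : Word n r) : Cong n r (Word.lam fun i => Word.alpha i w) w
  | alpha_lam (w : Fin n → Word n r) (i : Fin n) :
      Cong n r (Word.alpha i (Word.lam w)) (w i)

/-- The congruence as a setoid. -/
def wordSetoid (n r : ℕ) : Setoid (Word n r) where
  r := Cong n r
  iseqv := ⟨Cong.refl, Cong.symm, Cong.trans⟩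

/-- The Higman algebra `V_{n,r}`. -/
def V (n r : ℕ) : Type := Quotient (wordSetoid n r)

/-- The element of `V_{n,r}` represented by a word. -/
def V.mk {n r : ℕ} (w : Word n r) : V n r := Quotient.mk (wordSetoid n r) w

/-- A chosen representative; only used to apply `λ` to a tuple of classes. -/
noncomputable def V.rep {n r : ℕ} (v : V n r) : Word n r := Quotient.out v

theorem V.mk_rep {n r : ℕ} (v : V n r) : V.mk (V.rep v) = v := Quotient.out_eq v

theorem V.mk_eq_mk {n r : ℕ} {u v : Word n r} : V.mk u = V.mk v ↔ Cong n r u v :=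
  Quotient.eq (r := wordSetoid n r)

/-- The operations of `V_{n,r}`, induced from those of the word algebra. -/
noncomputable instance instHigmanAlgebraV (n r : ℕ) : HigmanAlgebra n (V n r) where
  alpha j v := V.mk (Word.alpha j (V.rep v))
  lam w := V.mk (Word.lam fun i => V.rep (w i))
  lam_alpha v := by
    refine Eq.trans (V.mk_eq_mk.2 ?_) (V.mk_rep v)
    exact (Cong.lam_congr fun i => V.mk_eq_mk.1 (V.mk_rep _)).trans (Cong.lam_alpha _)
  alpha_lam w i := by
    refine Eq.trans (V.mk_eq_mk.2 ?_) (V.mk_rep (w i))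
    exact (Cong.alpha_congr i (V.mk_eq_mk.1 (V.mk_rep _))).trans (Cong.alpha_lam _ i)

theorem V.alpha_mk {n r : ℕ} (j : Fin n) (w : Word n r) :
    alpha j (V.mk w) = V.mk (Word.alpha j w) :=
  V.mk_eq_mk.2 (Cong.alpha_congr j (V.mk_eq_mk.1 (V.mk_rep _)))

theorem V.lam_mk {n r : ℕ} (w : Fin n → Word n r) :
    (lam (fun i => V.mk (w i)) : V n r) = V.mk (Word.lam w) :=
  V.mk_eq_mk.2 (Cong.lam_congr fun _ => V.mk_eq_mk.1 (V.mk_rep _))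

/-- The set `{x₁, …, xᵣ}` of standard generators of `V_{n,r}`. -/
def generators (n r : ℕ) : Set (V n r) := Set.range fun i : Fin r => V.mk (Word.gen i)

/-- `Y` is a basis (free generating set) of `V_{n,r}`: every map from `Y` to an algebra of the
variety extends uniquely to a homomorphism. -/
def IsBasis {n r : ℕ} (Y : Set (V n r)) : Prop :=
  ∀ (S : Type) [HigmanAlgebra n S] (θ : Y → S),
    ∃! h : V n r → S, IsHom n h ∧ ∀ y : Y, h y = θ y

/-- `Y'` arises from `Y` by replacing one `y ∈ Y` by `y α₁, …, y αₙ`. -/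
def IsSimpleExpansion {n r : ℕ} (Y Y' : Set (V n r)) : Prop :=
  ∃ y ∈ Y, Y' = (Y \ {y}) ∪ Set.range (fun i : Fin n => alpha i y)

/-- `Y'` is an expansion of `Y`. -/
def IsExpansion {n r : ℕ} (Y Y' : Set (V n r)) : Prop :=
  Relation.ReflTransGen IsSimpleExpansion Y Y'

/-- `Y'` arises from `Y` by replacing `n` distinct elements `y₁, …, yₙ` by `y₁ ⋯ yₙ λ`. -/
def IsSimpleContraction {n r : ℕ} (Y Y' : Set (V n r)) : Prop :=
  ∃ w : Fin n → V n r, Function.Injective w ∧ (∀ i, w i ∈ Y) ∧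
    Y' = (Y \ Set.range w) ∪ {lam w}

/-- `Y'` is a contraction of `Y`. -/
def IsContraction {n r : ℕ} (Y Y' : Set (V n r)) : Prop :=
  Relation.ReflTransGen IsSimpleContraction Y Y'

/-- An `A`-basis is an expansion of the set of standard generators. -/
def IsABasis {n r : ℕ} (X : Set (V n r)) : Prop := IsExpansion (generators n r) X

/-- `v α_{i₁} ⋯ α_{iₖ}` for `Γ = α_{i₁} ⋯ α_{iₖ}`. -/
noncomputable def descend {n r : ℕ} (v : V n r) (Γ : List (Fin n)) : V n r :=
  Γ.foldl (fun u i => alpha i u) v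

/-- The `A`-subalgebra `Y⟨A⟩ = Y A*` generated by `Y`, where `A = {α₁, …, αₙ}`. -/
def ASpan {n r : ℕ} (Y : Set (V n r)) : Set (V n r) :=
  {v | ∃ y ∈ Y, ∃ Γ : List (Fin n), v = descend y Γ}

/-- The Higman-Thompson group `G_{n,r}` of automorphisms of the algebra `V_{n,r}`. -/
def G (n r : ℕ) : Subgroup (Equiv.Perm (V n r)) where
  carrier := {ψ | IsHom n (ψ : V n r → V n r)}
  one_mem' := ⟨fun _ _ => rfl, fun _ => rfl⟩
  mul_mem' := by
    intro φ ψ hφ hψ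
    refine ⟨fun i v => ?_, fun w => ?_⟩
    · simp only [Equiv.Perm.mul_apply, hψ.1, hφ.1]
    · simp only [Equiv.Perm.mul_apply, hψ.2, hφ.2]
  inv_mem' := by
    intro φ hφ
    refine ⟨fun i v => ?_, fun w => ?_⟩
    · rw [Equiv.Perm.inv_eq_iff_eq, hφ.1]; simp
    · rw [Equiv.Perm.inv_eq_iff_eq, hφ.2]; simp

/-- The `k`-th member `y ψᵏ` of the `ψ`-orbit of `y`. -/
def orbit {n r : ℕ} (ψ : G n r) (y : V n r) (k : ℤ) : V n r :=
  ((ψ : Equiv.Perm (V n r)) ^ k) y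

/-- The subsequence of the sequence `(y ψⁱ)`, `i ∈ ℤ`, with index set `I` is an `X`-component:
a maximal nonempty subsequence such that everything between any two of its members
(these included) is in `X⟨A⟩`. -/
def IsXComponent {n r : ℕ} (ψ : G n r) (X : Set (V n r)) (y : V n r) (I : Set ℤ) : Prop :=
  Maximal (fun J : Set ℤ => J.Nonempty ∧
    ∀ p ∈ J, ∀ q ∈ J, ∀ k : ℤ, p ≤ k → k ≤ q → orbit ψ y k ∈ ASpan X) I

/-- The `X`-component with index set `I` is incomplete finite: for some member `z = y ψᵖ`
and some `m ≥ 0`, the elements `z, z ψ, …, z ψᵐ` are in `X⟨A⟩` but `z ψ⁻¹` and `z ψᵐ⁺¹` are not. -/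
def IsIncompleteFinite {n r : ℕ} (ψ : G n r) (X : Set (V n r)) (y : V n r) (I : Set ℤ) : Prop :=
  IsXComponent ψ X y I ∧ ∃ p ∈ I, ∃ m : ℕ,
    (∀ k : ℕ, k ≤ m → orbit ψ y (p + k) ∈ ASpan X) ∧
      orbit ψ y (p - 1) ∉ ASpan X ∧ orbit ψ y (p + m + 1) ∉ ASpan X

/-- `X` is an `A`-basis with respect to which `ψ` is in semi-normal form. -/
def IsSemiNormal {n r : ℕ} (ψ : G n r) (X : Set (V n r)) : Prop :=
  IsABasis X ∧ ∀ u ∈ ASpan X, ¬ ∃ (y : V n r) (I : Set ℤ),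
    IsIncompleteFinite ψ X y I ∧ ∃ k ∈ I, orbit ψ y k = u

/-- `X` is an `A`-basis with respect to which `ψ` is in quasi-normal form. -/
def IsQuasiNormal {n r : ℕ} (ψ : G n r) (X : Set (V n r)) : Prop :=
  IsSemiNormal ψ X ∧ ∀ X' : Set (V n r), IsContraction X X' → X' ≠ X → ¬ IsSemiNormal ψ X'

/-- The letters used to write words as finite data: `inl i` is the `i`-th generator,
`inr (some j)` is the `j`-th descending operation and `inr none` is `λ`. -/
abbrev Letter : Type := ℕ ⊕ Option ℕ

/-- The word as a finite sequence of letters, operations being written after their arguments. -/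
def Word.row {n r : ℕ} : Word n r → List Letter
  | .gen i => [Sum.inl i.val]
  | .alpha j w => w.row ++ [Sum.inr (some j.val)]
  | .lam w => (List.ofFn fun i => (w i).row).flatten ++ [Sum.inr none]

/-- The word `x α_{i₁} ⋯ α_{iₖ}`, for a generator `x` and `Γ = α_{i₁} ⋯ α_{iₖ}`. -/
def Word.descending {n r : ℕ} (p : Fin r × List (Fin n)) : Word n r :=
  p.2.foldl (fun w j => Word.alpha j w) (Word.gen p.1)

/-- The list `L` of pairs of words describes `ψ` by listing the images of the elements of a
finite basis: the first words represent the elements of a basis, the second ones their images. -/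
def Describes {n r : ℕ} (L : List (Word n r × Word n r)) (ψ : G n r) : Prop :=
  IsBasis {v : V n r | ∃ p ∈ L, v = V.mk p.1} ∧
    ∀ p ∈ L, (ψ : Equiv.Perm (V n r)) (V.mk p.1) = V.mk p.2

/-- A list of pairs of words as finite data. -/
def encodePairs {n r : ℕ} (L : List (Word n r × Word n r)) : List (List Letter × List Letter) :=
  L.map fun p => (p.1.row, p.2.row)

end Higman

/-!
Write `S_X = X⟨A⟩` for an `A`-basis `X`. An element of `S_X` lies in an incomplete finite
`X`-component exactly if its orbit leaves `S_X` in both directions (`isSemiNormal_iff`), and if this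
happens to `x Γ` with `x ∈ X`, it happens to `x`. Starting from the standard generators, expand at
elements `x ∈ X` whose orbits leave `S_X` in both directions, as long as there are any; such an
expansion replaces `S_X` by `S_X \ {x}`. An orbit that stays in `S_X` does not meet `x`, so each
expansion makes the finite set of elements with orbits leaving in both directions smaller, and the
process ends with a semi-normal form (`exists_greedy_isSemiNormal`). If `ψ` is in semi-normal form
with respect to some `Y` with `S_Y ⊆ S_X`, then `x ∉ S_Y`; hence `S_Y` is contained in every `S_X`
that is reached (`Greedy.ASpan_subset`). As inclusion of the subalgebras is the same as being an
expansion (`isExpansion_of_ASpan_subset`), the final `A`-basis is the only one with respect to which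
`ψ` is in quasi-normal form.

For the algorithm it remains to give a finite certificate for the greedy process and for its end,
and to search for it. That an orbit leaves `S_X` is seen at some power of `ψ`. That the forward
orbits of the elements of a subset `F` of `X` stay in `S_X` follows from a finite set `O ⊆ S_X` with
`F ⊆ O` and `O ψ ⊆ O⟨A⟩`. Such a set exists when `ψ` is in semi-normal form and `F` is the set of
all `x ∈ X` with forward orbit in `S_X`: every `x ∈ F` has a later image in `F⟨A⟩`
(`exists_pow_eq_descend`), and `O` consists of the stretches of orbits up to there.

All statements about `ψ` in a certificate are reduced to the given pairs of words. An element of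
`V_{n,r}` is determined by its descendants at any fixed depth (`eq_of_descend_eq`), and these lie in
`x⟨A⟩` and in the `A`-subalgebra generated by the given basis when the depth is large
(`IsBasis.exists_descend_mem`). There `ψ` is a replacement of words that is read off from the pairs
by evaluation (`Word.eval`, `readCode`). With sufficiently large bounds on the lengths of the
addresses involved, every true statement of the required form is certified (`Table.exists_check`),
every valid certificate describes the quasi-normal form (`Table.of_check`), and validity is
primitive recursive (`primrecPred_check`).
-/

namespace Higman

open HigmanAlgebra Filter

variable {n r : ℕ}

/-! ### Codes and the evaluation of words -/

/-- An element `x_i α_{j₁} ⋯ α_{jₖ}` of `x⟨A⟩`, given by the index `i` and the address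
`[j₁, …, jₖ]`. -/
abbrev Code (n r : ℕ) : Type := Fin r × List (Fin n)

/-- The element of `V_{n,r}` with a given code. -/
noncomputable def Code.val (c : Code n r) : V n r := V.mk (Word.descending c)

/-- The code of `c Γ`. -/
abbrev Code.app (c : Code n r) (Γ : List (Fin n)) : Code n r := (c.1, c.2 ++ Γ)

theorem descend_cons (v : V n r) (j : Fin n) (Γ : List (Fin n)) :
    descend v (j :: Γ) = descend (alpha j v) Γ := rfl

theorem descend_append (v : V n r) (Γ Δ : List (Fin n)) :
    descend v (Γ ++ Δ) = descend (descend v Γ) Δ := List.foldl_append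

theorem IsHom.map_descend {h : V n r → V n r} (hh : IsHom n h) (v : V n r) (Γ : List (Fin n)) :
    h (descend v Γ) = descend (h v) Γ := by
  induction Γ generalizing v with
  | nil => rfl
  | cons j Γ ih => rw [descend_cons, ih, hh.1, descend_cons]

theorem Code.val_eq (c : Code n r) : c.val = descend (V.mk (Word.gen c.1)) c.2 := by
  obtain ⟨i, Γ⟩ := c
  suffices H : ∀ w : Word n r,
      V.mk (Γ.foldl (fun w j => Word.alpha j w) w) = descend (V.mk w) Γ from H _
  induction Γ with
  | nil => intro w; rfl
  | cons j Γ ih => intro w; rw [descend_cons, V.alpha_mk, List.foldl_cons, ih]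

theorem Code.val_app (c : Code n r) (Γ : List (Fin n)) : (c.app Γ).val = descend c.val Γ := by
  rw [Code.val_eq, Code.val_eq, descend_append]

/-- Two elements whose descendants at depth `d` agree are equal. -/
theorem eq_of_descend_eq (d : ℕ) {v w : V n r}
    (h : ∀ Γ : List (Fin n), Γ.length = d → descend v Γ = descend w Γ) : v = w := by
  induction d generalizing v w with
  | zero => exact h [] rfl
  | succ d ih =>
    have : (fun i : Fin n => alpha i v) = fun i => alpha i w :=
      funext fun i => ih fun Γ hΓ => h (i :: Γ) (by simp [hΓ])
    rw [← lam_alpha (n := n) v, this, lam_alpha]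

/-- The code of `w Γ`, if it can be read off from the word `w` by cancelling every contraction
in `w` that it meets against a letter of the address. -/
def Word.eval : Word n r → List (Fin n) → Option (Code n r)
  | .gen i, Γ => some (i, Γ)
  | .alpha j w, Γ => w.eval (j :: Γ)
  | .lam _, [] => none
  | .lam w, j :: Γ => (w j).eval Γ

theorem Word.eval_sound {w : Word n r} {Γ : List (Fin n)} {c : Code n r}
    (h : w.eval Γ = some c) : descend (V.mk w) Γ = c.val := by
  induction w generalizing Γ with
  | gen i =>
    obtain rfl : (i, Γ) = c := by simpa [Word.eval] using h
    exact (Code.val_eq (i, Γ)).symm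
  | alpha j w ih =>
    rw [← V.alpha_mk, ← descend_cons]
    exact ih h
  | lam w ih =>
    cases Γ with
    | nil => simp [Word.eval] at h
    | cons j Γ =>
      rw [descend_cons, ← V.lam_mk, alpha_lam]
      exact ih j h

theorem Word.exists_eval_isSome (w : Word n r) :
    ∃ d, ∀ Γ : List (Fin n), d ≤ Γ.length → (w.eval Γ).isSome := by
  induction w with
  | gen i => exact ⟨0, fun Γ _ => rfl⟩
  | alpha j w ih =>
    obtain ⟨d, hd⟩ := ih
    exact ⟨d, fun Γ hΓ => hd _ (by simp; omega)⟩
  | lam w ih =>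
    choose d hd using ih
    refine ⟨Finset.univ.sup d + 1, fun Γ hΓ => ?_⟩
    cases Γ with
    | nil => simp at hΓ
    | cons j Γ =>
      have := Finset.le_sup (f := d) (Finset.mem_univ j)
      exact hd j Γ (by rw [List.length_cons] at hΓ; omega)

/-- Congruent words have the same evaluation at all long addresses. This is what makes the code
of an element of `x⟨A⟩` unique. -/
theorem Cong.eval_eq {u v : Word n r} (h : Cong n r u v) :
    ∃ d, ∀ Γ : List (Fin n), d ≤ Γ.length → u.eval Γ = v.eval Γ := by
  induction h with
  | refl w => exact ⟨0, fun _ _ => rfl⟩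
  | symm _ ih => exact ih.imp fun d hd Γ hΓ => (hd Γ hΓ).symm
  | trans _ _ ih₁ ih₂ =>
    obtain ⟨d₁, h₁⟩ := ih₁
    obtain ⟨d₂, h₂⟩ := ih₂
    exact ⟨max d₁ d₂, fun Γ hΓ => (h₁ Γ (le_trans (le_max_left _ _) hΓ)).trans
      (h₂ Γ (le_trans (le_max_right _ _) hΓ))⟩
  | alpha_congr j _ ih =>
    obtain ⟨d, hd⟩ := ih
    exact ⟨d, fun Γ hΓ => hd _ (by simp; omega)⟩
  | lam_congr _ ih =>
    choose d hd using ih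
    refine ⟨Finset.univ.sup d + 1, fun Γ hΓ => ?_⟩
    cases Γ with
    | nil => simp at hΓ
    | cons j Γ =>
      have := Finset.le_sup (f := d) (Finset.mem_univ j)
      exact hd j Γ (by rw [List.length_cons] at hΓ; omega)
  | lam_alpha w =>
    refine ⟨1, fun Γ hΓ => ?_⟩
    cases Γ with
    | nil => simp at hΓ
    | cons j Γ => rfl
  | alpha_lam w i => exact ⟨0, fun _ _ => rfl⟩

theorem Word.eval_descending (c : Code n r) (Γ : List (Fin n)) :
    (Word.descending c).eval Γ = some (c.app Γ) := by
  obtain ⟨i, Δ⟩ := c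
  suffices H : ∀ w : Word n r,
      (Δ.foldl (fun w j => Word.alpha j w) w).eval Γ = w.eval (Δ ++ Γ) from H _
  induction Δ with
  | nil => intro w; rfl
  | cons j Δ ih => intro w; rw [List.foldl_cons, ih]; rfl

theorem Code.val_injective (hn : 0 < n) : Function.Injective (Code.val : Code n r → V n r) := by
  intro c c' h
  obtain ⟨d, hd⟩ := (V.mk_eq_mk.1 h).eval_eq
  have := hd (List.replicate d ⟨0, hn⟩) (by simp)
  rw [Word.eval_descending, Word.eval_descending, Option.some_inj, Prod.mk.injEq] at this
  exact Prod.ext this.1 (List.append_cancel_right this.2)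

theorem mem_ASpan_generators {v : V n r} :
    v ∈ ASpan (generators n r) ↔ ∃ c : Code n r, c.val = v := by
  constructor
  · rintro ⟨_, ⟨i, rfl⟩, Γ, rfl⟩
    exact ⟨(i, Γ), Code.val_eq _⟩
  · rintro ⟨c, rfl⟩
    exact ⟨_, ⟨c.1, rfl⟩, c.2, Code.val_eq c⟩

/-! ### Subsets of `x⟨A⟩` and `A`-bases -/

theorem subset_ASpan (X : Set (V n r)) : X ⊆ ASpan X := fun x hx => ⟨x, hx, [], rfl⟩

theorem descend_mem_ASpan {X : Set (V n r)} {v : V n r} (hv : v ∈ ASpan X) (Γ : List (Fin n)) :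
    descend v Γ ∈ ASpan X := by
  obtain ⟨x, hx, Δ, rfl⟩ := hv
  exact ⟨x, hx, Δ ++ Γ, (descend_append _ _ _).symm⟩

theorem ASpan_subset_iff {X Y : Set (V n r)} : ASpan X ⊆ ASpan Y ↔ X ⊆ ASpan Y := by
  refine ⟨(subset_ASpan X).trans, ?_⟩
  rintro h _ ⟨x, hx, Γ, rfl⟩
  exact descend_mem_ASpan (h hx) Γ

theorem descend_inj (hn : 0 < n) {u : V n r} (hu : u ∈ ASpan (generators n r))
    {Γ Δ : List (Fin n)} (h : descend u Γ = descend u Δ) : Γ = Δ := by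
  obtain ⟨c, rfl⟩ := mem_ASpan_generators.1 hu
  rw [← Code.val_app, ← Code.val_app] at h
  exact List.append_cancel_left (Prod.ext_iff.1 (Code.val_injective hn h)).2

/-- Two elements of `x⟨A⟩` with a common descendant are comparable. -/
theorem comparable_of_descend_eq (hn : 0 < n) {u v : V n r} (hu : u ∈ ASpan (generators n r))
    (hv : v ∈ ASpan (generators n r)) {Γ Δ : List (Fin n)} (h : descend u Γ = descend v Δ) :
    (∃ E, Γ = E ++ Δ ∧ v = descend u E) ∨ ∃ E, Δ = E ++ Γ ∧ u = descend v E := by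
  obtain ⟨c, rfl⟩ := mem_ASpan_generators.1 hu
  obtain ⟨c', rfl⟩ := mem_ASpan_generators.1 hv
  rw [← Code.val_app, ← Code.val_app] at h
  obtain ⟨h₁, h₂⟩ := Prod.ext_iff.1 (Code.val_injective hn h)
  simp only at h₁ h₂
  obtain ⟨E, h₃, h₄⟩ | ⟨E, h₃, h₄⟩ := List.append_eq_append_iff.1 h₂
  · refine .inl ⟨E, h₄, ?_⟩
    rw [← Code.val_app]
    exact congrArg _ (Prod.ext h₁.symm h₃)
  · refine .inr ⟨E, h₄, ?_⟩
    rw [← Code.val_app]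
    exact congrArg _ (Prod.ext h₁ h₃)

/-- A finite antichain `X` of `x⟨A⟩`, in the order by descent, such that all sufficiently long
descendants of any element of `V_{n,r}` lie in `X⟨A⟩`. Every `A`-basis is of this kind
(`IsABasis.isCut`), and all that the argument needs about `A`-bases follows from it. -/
structure IsCut (X : Set (V n r)) : Prop where
  subset : X ⊆ ASpan (generators n r)
  antichain : ∀ x ∈ X, ∀ Γ, descend x Γ ∈ X → Γ = []
  finite : X.Finite
  absorbing : ∀ v : V n r, ∃ d, ∀ Γ : List (Fin n), d ≤ Γ.length → descend v Γ ∈ ASpan X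

theorem IsCut.span_subset {X : Set (V n r)} (hX : IsCut X) :
    ASpan X ⊆ ASpan (generators n r) := ASpan_subset_iff.2 hX.subset

theorem isCut_generators (hn : 0 < n) : IsCut (generators n r) where
  subset := subset_ASpan _
  antichain := by
    rintro _ ⟨i, rfl⟩ Γ ⟨j, hj⟩
    have : (Code.val (j, []) : V n r) = Code.val (i, Γ) := by
      rw [Code.val_eq, Code.val_eq]; exact hj
    exact (Prod.ext_iff.1 (Code.val_injective hn this)).2.symm
  finite := Set.finite_range _
  absorbing v := by
    obtain ⟨d, hd⟩ := v.rep.exists_eval_isSome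
    refine ⟨d, fun Γ hΓ => mem_ASpan_generators.2 ?_⟩
    obtain ⟨c, hc⟩ := Option.isSome_iff_exists.1 (hd Γ hΓ)
    exact ⟨c, by rw [← Word.eval_sound hc, V.mk_rep]⟩

/-- The simple expansion of `X` at `x`. -/
def expandAt (X : Set (V n r)) (x : V n r) : Set (V n r) :=
  (X \ {x}) ∪ Set.range fun i : Fin n => alpha i x

theorem ASpan_expandAt (hn : 0 < n) {X : Set (V n r)} (hX : IsCut X) {x : V n r} (hx : x ∈ X) :
    ASpan (expandAt X x) = ASpan X \ {x} := by
  apply Set.Subset.antisymm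
  · rintro _ ⟨y, ⟨hy, hyx⟩ | ⟨i, rfl⟩, Γ, rfl⟩
    · refine ⟨⟨y, hy, Γ, rfl⟩, fun h => hyx ?_⟩
      rw [Set.mem_singleton_iff] at h ⊢
      have := hX.antichain y hy Γ (h ▸ hx)
      subst this
      exact h
    · refine ⟨⟨x, hx, i :: Γ, rfl⟩, fun h => ?_⟩
      exact List.cons_ne_nil i Γ (descend_inj hn (hX.subset hx) (Γ := i :: Γ) (Δ := []) h)
  · rintro _ ⟨⟨y, hy, Γ, rfl⟩, h⟩
    by_cases hyx : y = x
    · subst hyx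
      cases Γ with
      | nil => exact absurd rfl h
      | cons j Γ => exact ⟨_, .inr ⟨j, rfl⟩, Γ, rfl⟩
    · exact ⟨y, .inl ⟨hy, hyx⟩, Γ, rfl⟩

theorem IsCut.expandAt (hn : 0 < n) {X : Set (V n r)} (hX : IsCut X) {x : V n r} (hx : x ∈ X) :
    IsCut (expandAt X x) where
  subset := by
    rintro y (⟨hy, -⟩ | ⟨i, rfl⟩)
    · exact hX.subset hy
    · exact descend_mem_ASpan (hX.subset hx) [i]
  antichain := by
    have hmem := hX.subset
    rintro y (⟨hy, hyx⟩ | ⟨i, rfl⟩) Γ (⟨hz, hzx⟩ | ⟨j, hj⟩)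
    · exact hX.antichain y hy Γ hz
    · exfalso
      obtain ⟨E, -, h⟩ | ⟨E, h, h'⟩ :=
        comparable_of_descend_eq hn (hmem hy) (hmem hx) (Γ := Γ) (Δ := [j]) hj.symm
      · obtain rfl := hX.antichain y hy E (h ▸ hx)
        exact hyx h.symm
      · obtain rfl := hX.antichain x hx E (h' ▸ hy)
        exact hyx h'
    · exfalso
      have := hX.antichain x hx (i :: Γ) hz
      simp at this
    · have h : descend x [j] = descend x (i :: Γ) := hj
      have := descend_inj hn (hmem hx) h
      simp only [List.cons.injEq] at this
      exact this.2.symm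
  finite := (hX.finite.subset Set.sdiff_subset).union (Set.finite_range _)
  absorbing v := by
    obtain ⟨d, hd⟩ := hX.absorbing v
    refine ⟨d + 1, fun Γ hΓ => ?_⟩
    rw [ASpan_expandAt hn hX hx]
    refine ⟨hd Γ (by omega), ?_⟩
    -- the prefix of `Γ` with its last letter removed still leads into `X⟨A⟩`
    obtain ⟨Γ', j, rfl⟩ : ∃ Γ' j, Γ = Γ' ++ [j] :=
      ⟨Γ.dropLast, Γ.getLast (by rintro rfl; simp at hΓ), (List.dropLast_append_getLast _).symm⟩
    obtain ⟨y, hy, Δ, h⟩ := hd Γ' (by rw [List.length_append, List.length_singleton] at hΓ; omega)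
    rw [descend_append, h, ← descend_append]
    intro h'
    rw [Set.mem_singleton_iff] at h'
    have := hX.antichain y hy _ (h' ▸ hx)
    simp at this

theorem IsABasis.isCut (hn : 0 < n) {X : Set (V n r)} (hX : IsABasis X) : IsCut X := by
  induction hX with
  | refl => exact isCut_generators hn
  | tail _ h ih =>
    obtain ⟨x, hx, rfl⟩ := h
    exact ih.expandAt hn hx

theorem IsABasis.expandAt {X : Set (V n r)} (hX : IsABasis X) {x : V n r} (hx : x ∈ X) :
    IsABasis (expandAt X x) := hX.tail ⟨x, hx, rfl⟩

theorem IsCut.eq_of_ASpan_eq {X Y : Set (V n r)} (hX : IsCut X) (hY : IsCut Y)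
    (h : ASpan X = ASpan Y) : X = Y := by
  have key : ∀ {X Y : Set (V n r)}, IsCut X → ASpan X = ASpan Y → X ⊆ Y := by
    intro X Y hX h x hx
    obtain ⟨y, hy, Γ, hxy⟩ := h ▸ subset_ASpan X hx
    obtain ⟨x', hx', Δ, hyx⟩ := h.symm ▸ subset_ASpan Y hy
    rw [hyx, ← descend_append] at hxy
    have h₀ := hX.antichain x' hx' _ (hxy ▸ hx)
    have h₁ : Γ = [] := (List.append_eq_nil_iff.1 h₀).2
    have h₂ : Δ = [] := (List.append_eq_nil_iff.1 h₀).1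
    subst h₁ h₂
    rw [hxy, List.append_nil, ← hyx]
    exact hy
  exact (key hX h).antisymm (key hY h.symm)

/-- For a homomorphism `h`, only finitely many elements of `X⟨A⟩` are mapped outside `Y⟨A⟩`. -/
theorem finite_escape {X Y : Set (V n r)} (hX : X.Finite) (hY : IsCut Y) {h : V n r → V n r}
    (hh : IsHom n h) : {v ∈ ASpan X | h v ∉ ASpan Y}.Finite := by
  choose d hd using fun v => hY.absorbing (h v)
  refine (hX.biUnion fun x _ => (List.finite_length_lt (Fin n) (d x)).image (descend x)).subset ?_
  rintro _ ⟨⟨x, hx, Γ, rfl⟩, hΓ⟩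
  refine Set.mem_biUnion hx ⟨Γ, ?_, rfl⟩
  by_contra hlt
  exact hΓ (hh.map_descend x Γ ▸ hd x Γ (not_lt.1 hlt))

/-- An `A`-basis whose `A`-subalgebra lies in that of `X` is an expansion of `X`. -/
theorem isExpansion_of_ASpan_subset (hn : 0 < n) {X Y : Set (V n r)} (hX : IsCut X)
    (hY : IsCut Y) (h : ASpan Y ⊆ ASpan X) : IsExpansion X Y := by
  have hfin : (ASpan X \ ASpan Y).Finite :=
    finite_escape hX.finite hY (h := id) ⟨fun _ _ => rfl, fun _ => rfl⟩
  induction hm : (ASpan X \ ASpan Y).ncard generalizing X with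
  | zero =>
    rw [Set.ncard_eq_zero hfin, Set.sdiff_eq_empty] at hm
    rw [hX.eq_of_ASpan_eq hY (hm.antisymm h)]
    exact .refl
  | succ m ih =>
    obtain ⟨_, ⟨x, hx, Γ, rfl⟩, hu⟩ : (ASpan X \ ASpan Y).Nonempty := by
      exact Set.nonempty_of_ncard_ne_zero (by omega)
    have hxY : x ∉ ASpan Y := fun hxY => hu (descend_mem_ASpan hxY Γ)
    have hspan := ASpan_expandAt hn hX hx
    have hdiff : ASpan (expandAt X x) \ ASpan Y = (ASpan X \ ASpan Y) \ {x} := by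
      rw [hspan, Set.sdiff_sdiff_comm]
    refine .head (b := expandAt X x) ⟨x, hx, rfl⟩ (ih (hX.expandAt hn hx) ?_ ?_ ?_)
    · rw [hspan]
      exact fun v hv => ⟨h hv, fun hvx => hxY (hvx ▸ hv)⟩
    · rw [hdiff]
      exact hfin.subset Set.sdiff_subset
    · have := Set.ncard_sdiff_singleton_of_mem (a := x) (s := ASpan X \ ASpan Y)
        ⟨subset_ASpan X hx, hxY⟩
      rw [hdiff, this, hm]
      rfl

theorem isSimpleContraction_expandAt (hn : 0 < n) {X : Set (V n r)} (hX : IsCut X) {x : V n r}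
    (hx : x ∈ X) : IsSimpleContraction (expandAt X x) X := by
  refine ⟨fun i => alpha i x, fun i j hij => ?_, fun i => .inr ⟨i, rfl⟩, ?_⟩
  · have := descend_inj hn (hX.subset hx) (Γ := [i]) (Δ := [j]) hij
    simpa using this
  · rw [lam_alpha, expandAt, Set.union_sdiff_right, Set.sdiff_sdiff_comm]
    have : X \ Set.range (fun i : Fin n => alpha i x) = X := by
      rw [sdiff_eq_left, Set.disjoint_left]
      rintro _ hy ⟨i, rfl⟩
      have := hX.antichain x hx [i] hy
      simp at this
    rw [this, Set.sdiff_union_self, Set.union_singleton, Set.insert_eq_of_mem hx]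

theorem IsExpansion.isContraction (hn : 0 < n) {X Y : Set (V n r)} (hX : IsCut X)
    (h : IsExpansion X Y) : IsCut Y ∧ IsContraction Y X := by
  induction h with
  | refl => exact ⟨hX, .refl⟩
  | tail _ h ih =>
    obtain ⟨x, hx, rfl⟩ := h
    exact ⟨ih.1.expandAt hn hx, ih.2.head (isSimpleContraction_expandAt hn ih.1 hx)⟩

theorem IsContraction.ASpan_subset {X Y : Set (V n r)} (h : IsContraction X Y) :
    ASpan X ⊆ ASpan Y := by
  induction h with
  | refl => exact subset_rfl
  | tail _ h ih =>
    obtain ⟨w, -, -, rfl⟩ := h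
    refine ih.trans (ASpan_subset_iff.2 fun y hy => ?_)
    by_cases hyw : y ∈ Set.range w
    · obtain ⟨i, rfl⟩ := hyw
      exact ⟨lam w, .inr rfl, [i], (alpha_lam w i).symm⟩
    · exact subset_ASpan _ (.inl ⟨hy, hyw⟩)

/-! ### Semi-normal forms -/

/-- The forward `σ`-orbit of `u` stays in `S`. -/
def Stays (σ : Equiv.Perm (V n r)) (S : Set (V n r)) (u : V n r) : Prop :=
  ∀ k : ℕ, (σ ^ k) u ∈ S

/-- The `σ`-orbit of `u` leaves `S` in both directions. -/
def Leaves (σ : Equiv.Perm (V n r)) (S : Set (V n r)) (u : V n r) : Prop :=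
  ¬ Stays σ S u ∧ ¬ Stays σ⁻¹ S u

theorem Stays.mono {σ : Equiv.Perm (V n r)} {S T : Set (V n r)} (h : S ⊆ T) {u : V n r}
    (hu : Stays σ S u) : Stays σ T u := fun k => h (hu k)

theorem isHom_coe (ψ : G n r) : IsHom n ((ψ : Equiv.Perm (V n r)) : V n r → V n r) := ψ.2

theorem isHom_pow (ψ : G n r) (k : ℕ) :
    IsHom n (((ψ : Equiv.Perm (V n r)) ^ k : Equiv.Perm (V n r)) : V n r → V n r) :=
  ((G n r).pow_mem ψ.2 k)

theorem Stays.descend {ψ : G n r} {X : Set (V n r)} {u : V n r}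
    (hu : Stays (ψ : Equiv.Perm (V n r)) (ASpan X) u) (Γ : List (Fin n)) :
    Stays (ψ : Equiv.Perm (V n r)) (ASpan X) (descend u Γ) := fun k => by
  rw [(isHom_pow ψ k).map_descend]
  exact descend_mem_ASpan (hu k) Γ

theorem orbit_natCast (ψ : G n r) (u : V n r) (k : ℕ) :
    orbit ψ u k = ((ψ : Equiv.Perm (V n r)) ^ k) u := by rw [orbit, zpow_natCast]

theorem orbit_neg_natCast (ψ : G n r) (u : V n r) (k : ℕ) :
    orbit ψ u (-k) = (((ψ : Equiv.Perm (V n r))⁻¹) ^ k) u := by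
  rw [orbit, zpow_neg, zpow_natCast, inv_pow]

theorem orbit_orbit (ψ : G n r) (u : V n r) (k l : ℤ) :
    orbit ψ (orbit ψ u k) l = orbit ψ u (l + k) := by
  rw [orbit, orbit, orbit, zpow_add, Equiv.Perm.mul_apply]

/-- An element of `X⟨A⟩` lies in an incomplete finite component exactly if its orbit leaves
`X⟨A⟩` in both directions. -/
theorem isSemiNormal_iff {ψ : G n r} {X : Set (V n r)} : IsSemiNormal ψ X ↔
    IsABasis X ∧ ∀ u ∈ ASpan X, ¬ Leaves (ψ : Equiv.Perm (V n r)) (ASpan X) u := by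
  refine and_congr_right fun _ => forall₂_congr fun u hu => not_congr ⟨?_, ?_⟩
  · rintro ⟨y, I, ⟨hI, p, hp, m, -, h₁, h₂⟩, k, hk, rfl⟩
    have hI := hI.1
    have hpk : p ≤ k := by
      by_contra hlt
      exact h₁ (hI.2 k hk p hp (p - 1) (by omega) (by omega))
    have hkp : k ≤ p + m := by
      by_contra hlt
      exact h₂ (hI.2 p hp k hk (p + m + 1) (by omega) (by omega))
    refine ⟨fun h => h₂ ?_, fun h => h₁ ?_⟩
    · have := h (p + m + 1 - k).toNat
      rw [← orbit_natCast, orbit_orbit, Int.toNat_of_nonneg (by omega)] at this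
      convert this using 2
      ring
    · have := h (k - (p - 1)).toNat
      rw [← orbit_neg_natCast, orbit_orbit, Int.toNat_of_nonneg (by omega)] at this
      convert this using 2
      ring
  · rintro ⟨h₁, h₂⟩
    classical
    rw [Stays, not_forall] at h₁ h₂
    -- the component of `u` runs from `-b + 1` to `a - 1`, where `a` and `b` are the first exits
    obtain ⟨a, ha, ha'⟩ : ∃ a : ℕ, orbit ψ u a ∉ ASpan X ∧
        ∀ k : ℕ, k < a → orbit ψ u k ∈ ASpan X := by
      refine ⟨Nat.find h₁, ?_, fun k hk => ?_⟩
      · rw [orbit_natCast]; exact Nat.find_spec h₁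
      · rw [orbit_natCast]; exact not_not.1 (Nat.find_min h₁ hk)
    obtain ⟨b, hb, hb'⟩ : ∃ b : ℕ, orbit ψ u (-b) ∉ ASpan X ∧
        ∀ k : ℕ, k < b → orbit ψ u (-k) ∈ ASpan X := by
      refine ⟨Nat.find h₂, ?_, fun k hk => ?_⟩
      · rw [orbit_neg_natCast]; exact Nat.find_spec h₂
      · rw [orbit_neg_natCast]; exact not_not.1 (Nat.find_min h₂ hk)
    have h0 : orbit ψ u 0 = u := by simp [orbit]
    have ha0 : 0 < a := Nat.pos_of_ne_zero fun h => ha (by rw [h, Nat.cast_zero, h0]; exact hu)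
    have hb0 : 0 < b :=
      Nat.pos_of_ne_zero fun h => hb (by rw [h, Nat.cast_zero, neg_zero, h0]; exact hu)
    have hmem : ∀ k : ℤ, -b < k → k < a → orbit ψ u k ∈ ASpan X := by
      intro k hk₁ hk₂
      obtain ⟨m, rfl | rfl⟩ := Int.eq_nat_or_neg k
      · exact ha' m (by omega)
      · exact hb' m (by omega)
    refine ⟨u, Set.Ioo (-b : ℤ) a, ⟨⟨⟨⟨0, by simp; omega⟩, ?_⟩, ?_⟩, -b + 1, ?_, a + b - 2,
      ?_, ?_, ?_⟩, 0, by simp; omega, h0⟩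
    · exact fun p hp q hq k hk₁ hk₂ => hmem k (lt_of_lt_of_le hp.1 hk₁) (lt_of_le_of_lt hk₂ hq.2)
    · rintro J ⟨-, hJ⟩ hIJ k hk
      have h0J : (0 : ℤ) ∈ J := hIJ (by simp; omega)
      constructor
      · by_contra hlt
        exact hb (hJ k hk 0 h0J (-b) (by omega) (by omega))
      · by_contra hlt
        exact ha (hJ 0 h0J k hk a (by omega) (by omega))
    · simp; omega
    · exact fun k hk => hmem _ (by omega) (by omega)
    · rwa [add_sub_cancel_right]
    · rwa [show (-(b : ℤ) + 1 + (a + b - 2 : ℕ) + 1) = a by omega]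

/-- If `σ` maps only finitely many elements of `S` outside `S`, then only finitely many elements
of `S` have orbits that leave `S` in both directions: each is reached by going back, for a bounded
time, from one of those finitely many elements. -/
theorem finite_leaves {σ : Equiv.Perm (V n r)} {S : Set (V n r)}
    (hfin : {v ∈ S | σ v ∉ S}.Finite) : {u ∈ S | Leaves σ S u}.Finite := by
  have hm : ∀ t, ∃ m : ℕ, ¬ Stays σ⁻¹ S t → (σ⁻¹ ^ m) t ∉ S := by
    intro t
    by_cases h : Stays σ⁻¹ S t
    · exact ⟨0, fun h' => absurd h h'⟩
    · obtain ⟨m, hm⟩ := not_forall.1 h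
      exact ⟨m, fun _ => hm⟩
  choose m hm using hm
  refine (hfin.biUnion fun t _ => (Set.finite_Iio (m t)).image fun k => (σ⁻¹ ^ k) t).subset ?_
  rintro u ⟨hu, h₁, h₂⟩
  classical
  rw [Stays, not_forall] at h₁ h₂
  have hpos : Nat.find h₁ ≠ 0 := fun h => by
    have := Nat.find_spec h₁
    rw [h] at this
    exact this hu
  obtain ⟨k, hk⟩ := Nat.exists_eq_succ_of_ne_zero hpos
  have hkS : ∀ i ≤ k, (σ ^ i) u ∈ S := fun i hi => not_not.1 (Nat.find_min h₁ (by omega))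
  have hkS' : (σ ^ (k + 1)) u ∉ S := by
    have := Nat.find_spec h₁
    rwa [hk] at this
  have hback : ∀ i, (σ⁻¹ ^ (i + k)) ((σ ^ k) u) = (σ⁻¹ ^ i) u := fun i => by
    rw [← Equiv.Perm.mul_apply, pow_add, mul_assoc, inv_pow σ k, inv_mul_cancel, mul_one]
  refine Set.mem_biUnion (x := (σ ^ k) u) ⟨hkS k le_rfl, ?_⟩ ⟨k, ?_, ?_⟩
  · rwa [← Equiv.Perm.mul_apply, ← pow_succ']
  · obtain ⟨j, hj⟩ := h₂
    have := hm ((σ ^ k) u) fun h => hj (hback j ▸ h (j + k))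
    by_contra hlt
    refine this ?_
    have h := hkS (k - m ((σ ^ k) u)) (by omega)
    convert h using 1
    rw [← Equiv.Perm.mul_apply]
    congr 1
    rw [inv_pow, inv_mul_eq_iff_eq_mul, ← pow_add]
    congr 1
    rw [Set.mem_Iio, not_lt] at hlt
    omega
  · simp

/-! ### The greedy construction of the quasi-normal form -/

/-- `X` arises from the standard generators by successive simple expansions, each one at an
element `x` whose orbit leaves, in both directions, the `A`-subalgebra reached so far. The list
`B` holds the codes of these elements, the latest one first. -/
inductive Greedy (σ : Equiv.Perm (V n r)) : List (Code n r) → Set (V n r) → Prop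
  | nil : Greedy σ [] (generators n r)
  | cons {B : List (Code n r)} {X : Set (V n r)} (c : Code n r) : Greedy σ B X → c.val ∈ X →
      Leaves σ (ASpan X) c.val → Greedy σ (c :: B) (expandAt X c.val)

theorem Greedy.isABasis {σ : Equiv.Perm (V n r)} {B : List (Code n r)} {X : Set (V n r)}
    (h : Greedy σ B X) : IsABasis X := by
  induction h with
  | nil => exact .refl
  | cons c _ hc _ ih => exact ih.expandAt hc

theorem Greedy.mem_ASpan (hn : 0 < n) {σ : Equiv.Perm (V n r)} {B : List (Code n r)}
    {X : Set (V n r)} (h : Greedy σ B X) {c : Code n r} : c.val ∈ ASpan X ↔ c ∉ B := by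
  induction h with
  | nil => exact iff_of_true (mem_ASpan_generators.2 ⟨c, rfl⟩) List.not_mem_nil
  | cons c' h hc _ ih =>
    rw [ASpan_expandAt hn (h.isABasis.isCut hn) hc, Set.mem_sdiff, ih, Set.mem_singleton_iff,
      (Code.val_injective hn).eq_iff, List.mem_cons]
    tauto

/-- The greedy construction only removes elements that no semi-normal `A`-basis can generate. -/
theorem Greedy.ASpan_subset (hn : 0 < n) {ψ : G n r} {B : List (Code n r)} {X Y : Set (V n r)}
    (h : Greedy (ψ : Equiv.Perm (V n r)) B X) (hY : IsSemiNormal ψ Y) : ASpan Y ⊆ ASpan X := by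
  rw [isSemiNormal_iff] at hY
  induction h with
  | nil => exact (hY.1.isCut hn).span_subset
  | cons c h hc hl ih =>
    rw [ASpan_expandAt hn (h.isABasis.isCut hn) hc]
    refine fun v hv => ⟨ih hv, fun hvc => ?_⟩
    rw [Set.mem_singleton_iff] at hvc
    subst hvc
    exact hY.2 _ hv ⟨fun hs => hl.1 (hs.mono ih), fun hs => hl.2 (hs.mono ih)⟩

/-- The greedy construction ends in a semi-normal form: each expansion removes an element from
the finite set of those whose orbits leave the `A`-subalgebra in both directions. -/
theorem exists_greedy_isSemiNormal (hn : 0 < n) (ψ : G n r) :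
    ∃ B X, Greedy (ψ : Equiv.Perm (V n r)) B X ∧ IsSemiNormal ψ X := by
  set σ : Equiv.Perm (V n r) := ψ.1
  suffices H : ∀ (m : ℕ) (B : List (Code n r)) (X : Set (V n r)), Greedy σ B X →
      {u ∈ ASpan X | Leaves σ (ASpan X) u}.ncard = m →
        ∃ B X, Greedy σ B X ∧ IsSemiNormal ψ X from H _ _ _ .nil rfl
  intro m
  induction m using Nat.strong_induction_on with
  | _ m ih =>
    intro B X hX hm
    have hcut := hX.isABasis.isCut hn
    by_cases hsn : IsSemiNormal ψ X
    · exact ⟨B, X, hX, hsn⟩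
    rw [isSemiNormal_iff] at hsn
    push Not at hsn
    obtain ⟨_, ⟨x, hx, Γ, rfl⟩, hl⟩ := hsn hX.isABasis
    have hxl : Leaves σ (ASpan X) x :=
      ⟨fun h => hl.1 (h.descend Γ), fun h => hl.2 (Stays.descend (ψ := ψ⁻¹) h Γ)⟩
    obtain ⟨c, rfl⟩ := mem_ASpan_generators.1 (hcut.subset hx)
    refine ih _ ?_ _ _ (hX.cons c hx hxl) rfl
    rw [← hm]
    refine Set.ncard_lt_ncard ?_ (finite_leaves (finite_escape hcut.finite hcut ψ.2))
    have hspan := ASpan_expandAt hn hcut hx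
    rw [hspan]
    -- an orbit that stays in `X⟨A⟩` does not meet `x`
    have hstay : ∀ {τ : Equiv.Perm (V n r)} {u : V n r}, ¬ Stays τ (ASpan X) c.val →
        Stays τ (ASpan X) u → Stays τ (ASpan X \ {c.val}) u := by
      intro τ u hτ hu k
      refine ⟨hu k, fun hk => hτ fun j => ?_⟩
      rw [Set.mem_singleton_iff] at hk
      rw [← hk, ← Equiv.Perm.mul_apply, ← pow_add]
      exact hu _
    refine (Set.ssubset_iff_of_subset ?_).2 ⟨c.val, ⟨subset_ASpan X hx, hxl⟩, fun h => h.1.2 rfl⟩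
    rintro u ⟨⟨hu, -⟩, h₁, h₂⟩
    exact ⟨hu, fun h => h₁ (hstay hxl.1 h), fun h => h₂ (hstay hxl.2 h)⟩

theorem Greedy.isQuasiNormal (hn : 0 < n) {ψ : G n r} {B : List (Code n r)} {X : Set (V n r)}
    (h : Greedy (ψ : Equiv.Perm (V n r)) B X) (hX : IsSemiNormal ψ X) : IsQuasiNormal ψ X :=
  ⟨hX, fun _ hc hne hX' => hne <| (hX'.1.isCut hn).eq_of_ASpan_eq (hX.1.isCut hn)
    ((h.ASpan_subset hn hX').antisymm hc.ASpan_subset)⟩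

theorem IsQuasiNormal.eq_of_greedy (hn : 0 < n) {ψ : G n r} {B : List (Code n r)}
    {X Y : Set (V n r)} (h : Greedy (ψ : Equiv.Perm (V n r)) B X) (hX : IsSemiNormal ψ X)
    (hY : IsQuasiNormal ψ Y) : Y = X := by
  have hXc := hX.1.isCut hn
  by_contra hne
  exact hY.2 X ((isExpansion_of_ASpan_subset hn hXc (hY.1.1.isCut hn)
    (h.ASpan_subset hn hY.1)).isContraction hn hXc).2 (Ne.symm hne) hX

theorem existsUnique_isQuasiNormal (hn : 0 < n) (ψ : G n r) :
    ∃! X : Set (V n r), IsQuasiNormal ψ X := by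
  obtain ⟨B, X, hB, hX⟩ := exists_greedy_isSemiNormal hn ψ
  exact ⟨X, hB.isQuasiNormal hn hX, fun Y hY => hY.eq_of_greedy hn hB hX⟩

/-! ### Codes as finite data and the evaluation of rows -/

/-- Codes as data that does not depend on `n` and `r`. -/
abbrev NCode : Type := ℕ × List ℕ

/-- The finite data of a code. -/
def Code.toN (c : Code n r) : NCode := (c.1.val, c.2.map Fin.val)

/-- The data of `c Γ`. -/
abbrev NCode.app (c : NCode) (Γ : List ℕ) : NCode := (c.1, c.2 ++ Γ)

theorem Code.toN_injective : Function.Injective (Code.toN : Code n r → NCode) := by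
  rintro ⟨i, Γ⟩ ⟨j, Δ⟩ h
  simp only [Code.toN, Prod.mk.injEq] at h
  exact Prod.ext (Fin.ext h.1) (Fin.val_injective.list_map h.2)

theorem Code.toN_app (c : Code n r) (Γ : List (Fin n)) :
    (c.app Γ).toN = c.toN.app (Γ.map Fin.val) := by
  simp [Code.toN]

theorem Code.exists_app_of_toN_eq {c c' : Code n r} {E : List ℕ} (h : c'.toN = c.toN.app E) :
    ∃ E' : List (Fin n), E = E'.map Fin.val ∧ c' = c.app E' := by
  simp only [Code.toN, Prod.mk.injEq] at h
  obtain ⟨l₁, l₂, h₁, h₂, h₃⟩ := List.map_eq_append_iff.1 h.2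
  refine ⟨l₂, h₃.symm, Prod.ext (Fin.ext h.1) ?_⟩
  rw [h₁, Fin.val_injective.list_map h₂]

/-- The data is that of a code for `n` and `r`. -/
def NCode.Valid (n r : ℕ) (c : NCode) : Prop := c.1 < r ∧ ∀ j ∈ c.2, j < n

theorem NCode.valid_iff {c : NCode} : c.Valid n r ↔ ∃ c' : Code n r, c'.toN = c := by
  constructor
  · rintro ⟨h₁, h₂⟩
    obtain ⟨Γ, hΓ⟩ : ∃ Γ : List (Fin n), Γ.map Fin.val = c.2 :=
      ⟨c.2.pmap (fun j hj => ⟨j, hj⟩) h₂, by simp [List.map_pmap]⟩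
    exact ⟨(⟨c.1, h₁⟩, Γ), Prod.ext rfl hΓ⟩
  · rintro ⟨c', rfl⟩
    exact ⟨c'.1.2, fun j hj => by
      obtain ⟨i, -, rfl⟩ := List.mem_map.1 hj
      exact i.2⟩

/-- The state of the evaluation of a row at an address: the evaluation has halted with a result,
or some number of arguments is still to be skipped before the word to be evaluated at the
given address is met. -/
abbrev ReadState : Type := Option NCode ⊕ (ℕ × List ℕ)

/-- One step of the evaluation of a row at an address. The letters are read from the last one to
the first one, hence each operation before its arguments and these from the last to the first. -/
def readLetter (n : ℕ) (l : Letter) (s : ReadState) : ReadState :=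
  match s, l with
  | .inl res, _ => .inl res
  | .inr (0, Γ), .inl i => .inl (some (i, Γ))
  | .inr (0, Γ), .inr (some j) => .inr (0, j :: Γ)
  | .inr (0, []), .inr none => .inl none
  | .inr (0, j :: Γ), .inr none => .inr (n - 1 - j, Γ)
  | .inr (k + 1, Γ), .inl _ => .inr (k, Γ)
  | .inr (k + 1, Γ), .inr (some _) => .inr (k + 1, Γ)
  | .inr (k + 1, Γ), .inr none => .inr (k + n, Γ)

/-- The evaluation of a row at an address. -/
def readCode (n : ℕ) (row : List Letter) (Γ : List ℕ) : Option NCode :=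
  Sum.elim id (fun _ => none) (row.foldr (readLetter n) (.inr (0, Γ)))

theorem foldr_readLetter_inl (row : List Letter) (res : Option NCode) :
    row.foldr (readLetter n) (.inl res) = .inl res := by
  induction row with
  | nil => rfl
  | cons l row ih => rw [List.foldr_cons, ih]; rfl

theorem foldr_readLetter_flatten {rows : List (List Letter)}
    (h : ∀ row ∈ rows, ∀ k Γ,
      row.foldr (readLetter n) (.inr (k + 1, Γ)) = .inr (k, Γ)) (k : ℕ) (Γ : List ℕ) :
    rows.flatten.foldr (readLetter n) (.inr (k + rows.length, Γ)) = .inr (k, Γ) := by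
  induction rows generalizing k with
  | nil => rfl
  | cons row rows ih =>
    rw [List.flatten_cons, List.foldr_append, List.length_cons,
      show k + (rows.length + 1) = (k + 1) + rows.length by omega,
      ih (fun row' h' => h row' (List.mem_cons_of_mem _ h')), h row List.mem_cons_self]

theorem Word.foldr_readLetter_succ (w : Word n r) (k : ℕ) (Γ : List ℕ) :
    w.row.foldr (readLetter n) (.inr (k + 1, Γ)) = .inr (k, Γ) := by
  induction w generalizing k Γ with
  | gen i => rfl
  | alpha j w ih => rw [Word.row, List.foldr_append]; exact ih k Γ
  | lam w ih =>
    rw [Word.row, List.foldr_append]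
    have := foldr_readLetter_flatten (n := n) (rows := List.ofFn fun i => (w i).row)
      (fun row hrow k Γ' => ?_) k Γ
    · rwa [List.length_ofFn] at this
    · obtain ⟨i, rfl⟩ := (List.mem_ofFn' _ _).1 hrow
      exact ih i k Γ'

theorem foldr_readLetter_flatten_getElem {rows : List (List Letter)}
    (h : ∀ row ∈ rows, ∀ k Γ,
      row.foldr (readLetter n) (.inr (k + 1, Γ)) = .inr (k, Γ)) (Γ : List ℕ)
    {j : ℕ} (hj : j < rows.length) {res : Option NCode}
    (hres : rows[j].foldr (readLetter n) (.inr (0, Γ)) = .inl res) :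
    rows.flatten.foldr (readLetter n) (.inr (rows.length - 1 - j, Γ)) = .inl res := by
  induction rows generalizing j with
  | nil => simp at hj
  | cons row rows ih =>
    have h' : ∀ row ∈ rows, ∀ k Γ, row.foldr (readLetter n) (.inr (k + 1, Γ)) = .inr (k, Γ) :=
      fun row' h' => h row' (List.mem_cons_of_mem _ h')
    rw [List.flatten_cons, List.foldr_append, List.length_cons]
    cases j with
    | zero =>
      have := foldr_readLetter_flatten h' 0 Γ
      rw [Nat.zero_add] at this
      rw [show rows.length + 1 - 1 - 0 = rows.length by omega, this]
      exact hres
    | succ j =>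
      rw [show rows.length + 1 - 1 - (j + 1) = rows.length - 1 - j by omega,
        ih h' (by simpa using hj) hres, foldr_readLetter_inl]

theorem Word.foldr_readLetter_zero (w : Word n r) (Γ : List (Fin n)) :
    w.row.foldr (readLetter n) (.inr (0, Γ.map Fin.val)) = .inl ((w.eval Γ).map Code.toN) := by
  induction w generalizing Γ with
  | gen i => rfl
  | alpha j w ih => rw [Word.row, List.foldr_append]; exact ih (j :: Γ)
  | lam w ih =>
    rw [Word.row, List.foldr_append]
    cases Γ with
    | nil => exact foldr_readLetter_inl _ _
    | cons j Γ =>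
      have := foldr_readLetter_flatten_getElem (n := n) (rows := List.ofFn fun i => (w i).row)
        (fun row hrow k Γ' => ?_) (Γ.map Fin.val) (j := j) (by simp)
        (res := ((w j).eval Γ).map Code.toN) (by simpa using ih j Γ)
      · rwa [List.length_ofFn] at this
      · obtain ⟨i, rfl⟩ := (List.mem_ofFn' _ _).1 hrow
        exact Word.foldr_readLetter_succ _ _ _

theorem readCode_row (w : Word n r) (Γ : List (Fin n)) :
    readCode n w.row (Γ.map Fin.val) = (w.eval Γ).map Code.toN := by
  rw [readCode, Word.foldr_readLetter_zero]; rfl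

/-! ### The search for certificates -/

/-- The addresses of length `d`. -/
def words (n : ℕ) : ℕ → List (List ℕ)
  | 0 => [[]]
  | d + 1 => (words n d).flatMap fun Γ => (List.range n).map fun j => j :: Γ

/-- The addresses of length at most `d`. -/
def shortWords (n d : ℕ) : List (List ℕ) := (List.range (d + 1)).flatMap (words n)

theorem mem_words {d : ℕ} {Γ : List ℕ} :
    Γ ∈ words n d ↔ ∃ Δ : List (Fin n), Δ.length = d ∧ Δ.map Fin.val = Γ := by
  induction d generalizing Γ with
  | zero => simp [words, eq_comm]
  | succ d ih =>
    simp only [words, List.mem_flatMap, List.mem_map, List.mem_range, ih]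
    constructor
    · rintro ⟨_, ⟨Δ, rfl, rfl⟩, j, hj, rfl⟩
      exact ⟨⟨j, hj⟩ :: Δ, rfl, rfl⟩
    · rintro ⟨Δ, hΔ, rfl⟩
      cases Δ with
      | nil => simp at hΔ
      | cons j Δ => exact ⟨_, ⟨Δ, by simpa using hΔ, rfl⟩, j, j.2, rfl⟩

theorem mem_shortWords {d : ℕ} {Γ : List ℕ} :
    Γ ∈ shortWords n d ↔ ∃ Δ : List (Fin n), Δ.length ≤ d ∧ Δ.map Fin.val = Γ := by
  simp only [shortWords, List.mem_flatMap, List.mem_range, mem_words, Nat.lt_succ_iff]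
  constructor
  · rintro ⟨_, h, Δ, rfl, h'⟩
    exact ⟨Δ, h, h'⟩
  · rintro ⟨Δ, h, h'⟩
    exact ⟨_, h, Δ, rfl, h'⟩

/-- A list of pairs of rows of words. -/
abbrev Rows : Type := List (List Letter × List Letter)

/-- The codes that are found to be the image of `p` under the automorphism described by `L`, when
the pairs in `L` are evaluated at the addresses of length at most `d`. -/
def step (n d : ℕ) (L : Rows) (p : NCode) : List NCode :=
  L.flatMap fun uv => (shortWords n d).filterMap fun Γ =>
    if readCode n uv.1 Γ = some p then readCode n uv.2 Γ else none

/-- The codes found by applying the automorphism `k` times. -/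
def reach (n d : ℕ) (L : Rows) (k : ℕ) (p : NCode) : List NCode :=
  (fun P : List NCode => P.flatMap (step n d L))^[k] [p]

/-- `c'` is certified to be the image of `c`, by a comparison at all addresses of length `e`. -/
def ImageCert (n e d : ℕ) (L : Rows) (c c' : NCode) : Prop :=
  ∀ Γ ∈ words n e, c'.app Γ ∈ step n d L (c.app Γ)

/-- For some `i ≤ k` the `i`-th image of `b` is certified not to be in `x⟨A⟩ \ B`: no code
outside `B` is consistent with what is known of its descendants at two addresses. -/
def LeavesCert (n e d k : ℕ) (L : Rows) (B : List NCode) (b : NCode) : Prop :=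
  ∃ i ∈ List.range (k + 1), ∃ Γ₁ ∈ words n e, ∃ Γ₂ ∈ words n e,
    ∃ q₁ ∈ reach n d L i (b.app Γ₁), ∃ q₂ ∈ reach n d L i (b.app Γ₂),
      ∀ Δ ∈ shortWords n q₁.2.length,
        (q₁.1, Δ) ∈ B ∨ (q₁.1, Δ ++ Γ₁) ≠ q₁ ∨ (q₁.1, Δ ++ Γ₂) ≠ q₂

/-- The first components of the triples in `O` are certified to generate an `A`-subalgebra inside
`x⟨A⟩ \ B` that is mapped into itself: a triple `(c, o, E)` says that the image of `c` is `o E`,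
where `o` is again a first component. -/
def StayCert (n r e d : ℕ) (L : Rows) (B : List NCode) (O : List (NCode × NCode × List ℕ)) :
    Prop :=
  ∀ o ∈ O, o.1.Valid n r ∧ o.1 ∉ B ∧ (o.2.1.app o.2.2).Valid n r ∧
    ImageCert n e d L o.1 (o.2.1.app o.2.2) ∧ o.2.1 ∈ O.map Prod.fst

/-- The codes of the elements of the simple expansion at the element with code `b`. -/
def expandList (n : ℕ) (b : NCode) (X : List NCode) : List NCode :=
  X.filter (fun c => c ≠ b) ++ (List.range n).map fun j => b.app [j]

/-- The codes of the elements of the `A`-basis reached by successive simple expansions at the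
members of `B`, from the last to the first. -/
def frontier (n r : ℕ) (B : List NCode) : List NCode :=
  B.foldr (expandList n) ((List.range r).map fun i => (i, []))

/-- The list `B` is certified to be a sequence of steps of the greedy construction. -/
def GreedyCert (n r e d k : ℕ) (L : Rows) : List NCode → Prop
  | [] => True
  | b :: B => GreedyCert n r e d k L B ∧ b ∈ frontier n r B ∧ LeavesCert n e d k L B b ∧
      LeavesCert n e d k (L.map Prod.swap) B b

/-- A certificate: the bounds `e`, `d` and `k`, the list of the elements to be expanded and the
lists that show that orbits stay, for the automorphism and for its inverse. -/
abbrev Cert : Type :=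
  (ℕ × ℕ × ℕ) × List NCode × List (NCode × NCode × List ℕ) × List (NCode × NCode × List ℕ)

/-- The certificate is valid for the automorphism described by `L`. -/
def Check (n r : ℕ) (L : Rows) (z : Cert) : Prop :=
  GreedyCert n r z.1.1 z.1.2.1 z.1.2.2 L z.2.1 ∧
    StayCert n r z.1.1 z.1.2.1 L z.2.1 z.2.2.1 ∧
    StayCert n r z.1.1 z.1.2.1 (L.map Prod.swap) z.2.1 z.2.2.2 ∧
    ∀ x ∈ frontier n r z.2.1, x ∈ z.2.2.1.map Prod.fst ∨ x ∈ z.2.2.2.map Prod.fst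

/-! ### Descriptions of automorphisms -/

/-- The pairs in `L` describe `ψ`, and every element of `V_{n,r}` has all its long descendants
among the descendants of the first components. Unlike `Describes` this passes to `ψ⁻¹`. -/
structure Table (L : List (Word n r × Word n r)) (ψ : G n r) : Prop where
  map_eq : ∀ p ∈ L, (ψ : Equiv.Perm (V n r)) (V.mk p.1) = V.mk p.2
  cover : ∀ v : V n r, ∃ e, ∀ Γ : List (Fin n), e ≤ Γ.length →
    descend v Γ ∈ ASpan {v : V n r | ∃ p ∈ L, v = V.mk p.1}

/-- All long descendants of any element lie in the `A`-subalgebra generated by a basis: the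
elements with this property form a subalgebra that contains the basis. -/
theorem IsBasis.exists_descend_mem {Y : Set (V n r)} (hY : IsBasis Y) (v : V n r) :
    ∃ e, ∀ Γ : List (Fin n), e ≤ Γ.length → descend v Γ ∈ ASpan Y := by
  let P : V n r → Prop := fun v => ∃ e, ∀ Γ : List (Fin n), e ≤ Γ.length → descend v Γ ∈ ASpan Y
  have hα : ∀ (i : Fin n) (v : V n r), P v → P (alpha i v) := by
    rintro i v ⟨e, he⟩
    exact ⟨e, fun Γ hΓ => he (i :: Γ) (by rw [List.length_cons]; omega)⟩
  have hlam : ∀ w : Fin n → V n r, (∀ i, P (w i)) → P (lam w) := by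
    intro w hw
    choose e he using hw
    refine ⟨Finset.univ.sup e + 1, fun Γ hΓ => ?_⟩
    cases Γ with
    | nil => simp at hΓ
    | cons j Γ =>
      have := Finset.le_sup (f := e) (Finset.mem_univ j)
      rw [descend_cons, alpha_lam]
      exact he j Γ (by rw [List.length_cons] at hΓ; omega)
  let _ : HigmanAlgebra n {v // P v} :=
    { alpha := fun i v => ⟨alpha i v.1, hα i _ v.2⟩
      lam := fun w => ⟨lam fun i => (w i).1, hlam _ fun i => (w i).2⟩
      lam_alpha := fun v => Subtype.ext (lam_alpha v.1)
      alpha_lam := fun w i => Subtype.ext (alpha_lam (fun i => (w i).1) i) }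
  obtain ⟨h, ⟨hh, hhY⟩, -⟩ := hY {v // P v} fun y =>
    ⟨y.1, 0, fun Γ _ => descend_mem_ASpan (subset_ASpan Y y.2) Γ⟩
  obtain ⟨_, -, huniq⟩ := hY (V n r) fun y => y.1
  have h₁ : (fun v => (h v).1) = id := by
    refine (huniq (fun v => (h v).1) ⟨⟨fun i v => congrArg Subtype.val (hh.1 i v),
      fun w => congrArg Subtype.val (hh.2 w)⟩, fun y => congrArg Subtype.val (hhY y)⟩).trans ?_
    exact (huniq id ⟨⟨fun _ _ => rfl, fun _ => rfl⟩, fun _ => rfl⟩).symm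
  have : (h v).1 = v := congrFun h₁ v
  exact this ▸ (h v).2

theorem Describes.table {L : List (Word n r × Word n r)} {ψ : G n r} (h : Describes L ψ) :
    Table L ψ := ⟨h.2, h.1.exists_descend_mem⟩

theorem Table.swap {L : List (Word n r × Word n r)} {ψ : G n r} (h : Table L ψ) :
    Table (L.map Prod.swap) ψ⁻¹ where
  map_eq := by
    intro _ hp'
    obtain ⟨p, hp, rfl⟩ := List.mem_map.1 hp'
    exact Equiv.Perm.inv_eq_iff_eq.2 (h.map_eq p hp).symm
  cover v := by
    obtain ⟨e, he⟩ := h.cover ((ψ⁻¹ : G n r).1 v)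
    refine ⟨e, fun Γ hΓ => ?_⟩
    obtain ⟨_, ⟨p, hp, rfl⟩, Δ, hΔ⟩ := he Γ hΓ
    refine ⟨_, ⟨p.swap, List.mem_map.2 ⟨p, hp, rfl⟩, rfl⟩, Δ, ?_⟩
    rw [Prod.fst_swap, ← h.map_eq p hp, ← (isHom_coe ψ).map_descend, ← hΔ,
      (isHom_coe ψ).map_descend]
    simp

theorem encodePairs_swap (L : List (Word n r × Word n r)) :
    encodePairs (L.map Prod.swap) = (encodePairs L).map Prod.swap := by
  simp [encodePairs, Function.comp_def]

/-- Long descendants of any element `v` arise by evaluation from the first components. -/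
theorem Table.exists_eval {L : List (Word n r × Word n r)} {ψ : G n r} (h : Table L ψ)
    (v : V n r) : ∃ e, ∀ Γ : List (Fin n), e ≤ Γ.length → ∃ p ∈ L, ∃ (Δ : List (Fin n))
      (c c' : Code n r), p.1.eval Δ = some c ∧ p.2.eval Δ = some c' ∧ c.val = descend v Γ := by
  obtain ⟨e, he⟩ := h.cover v
  obtain ⟨m, hm⟩ : ∃ m, ∀ p ∈ L, ∀ Δ : List (Fin n), m ≤ Δ.length →
      (p.1.eval Δ).isSome ∧ (p.2.eval Δ).isSome := by
    have : ∀ p ∈ {p | p ∈ L}, ∀ᶠ m in atTop, ∀ Δ : List (Fin n), m ≤ Δ.length →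
        (p.1.eval Δ).isSome ∧ (p.2.eval Δ).isSome := by
      intro p _
      obtain ⟨d₁, h₁⟩ := p.1.exists_eval_isSome
      obtain ⟨d₂, h₂⟩ := p.2.exists_eval_isSome
      filter_upwards [eventually_ge_atTop d₁, eventually_ge_atTop d₂] with m hm₁ hm₂ Δ hΔ
      exact ⟨h₁ Δ (hm₁.trans hΔ), h₂ Δ (hm₂.trans hΔ)⟩
    exact ((eventually_all_finite L.finite_toSet).2 this).exists
  refine ⟨e + m, fun Γ hΓ => ?_⟩
  obtain ⟨_, ⟨p, hp, rfl⟩, Δ, hΔ⟩ := he (Γ.take e) (by rw [List.length_take]; omega)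
  obtain ⟨h₁, h₂⟩ := hm p hp (Δ ++ Γ.drop e) (by rw [List.length_append, List.length_drop]; omega)
  obtain ⟨c, hc⟩ := Option.isSome_iff_exists.1 h₁
  obtain ⟨c', hc'⟩ := Option.isSome_iff_exists.1 h₂
  refine ⟨p, hp, _, c, c', hc, hc', ?_⟩
  rw [← Word.eval_sound hc, descend_append, ← hΔ, ← descend_append, List.take_append_drop]

/-! ### What the certificates prove -/

section
variable {L : List (Word n r × Word n r)} {ψ : G n r}

theorem Table.of_mem_step (h : Table L ψ) {d : ℕ} {c : Code n r} {q : NCode}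
    (hq : q ∈ step n d (encodePairs L) c.toN) :
    ∃ c' : Code n r, c'.toN = q ∧ c'.val = (ψ : Equiv.Perm (V n r)) c.val := by
  simp only [step, encodePairs, List.mem_flatMap, List.mem_map, List.mem_filterMap,
    mem_shortWords] at hq
  obtain ⟨_, ⟨p, hp, rfl⟩, _, ⟨Δ, -, rfl⟩, hq⟩ := hq
  rw [readCode_row, readCode_row] at hq
  split_ifs at hq with h₁
  obtain ⟨c₁, hc₁, h₁⟩ := Option.map_eq_some_iff.1 h₁
  obtain ⟨c', hc', rfl⟩ := Option.map_eq_some_iff.1 hq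
  obtain rfl := Code.toN_injective h₁
  refine ⟨c', rfl, ?_⟩
  rw [← Word.eval_sound hc', ← Word.eval_sound hc₁, (isHom_coe ψ).map_descend, h.map_eq p hp]

theorem reach_succ (d k : ℕ) (L : Rows) (p q : NCode) :
    q ∈ reach n d L (k + 1) p ↔ ∃ q' ∈ reach n d L k p, q ∈ step n d L q' := by
  rw [reach, Function.iterate_succ_apply', List.mem_flatMap]; rfl

theorem Table.of_mem_reach (h : Table L ψ) {d k : ℕ} {c : Code n r} {q : NCode}
    (hq : q ∈ reach n d (encodePairs L) k c.toN) :
    ∃ c' : Code n r, c'.toN = q ∧ c'.val = ((ψ : Equiv.Perm (V n r)) ^ k) c.val := by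
  induction k generalizing q with
  | zero => exact ⟨c, by simpa [reach, eq_comm] using hq, rfl⟩
  | succ k ih =>
    obtain ⟨q', hq', hq⟩ := (reach_succ _ _ _ _ _).1 hq
    obtain ⟨c', rfl, hc'⟩ := ih hq'
    obtain ⟨c'', rfl, hc''⟩ := h.of_mem_step hq
    exact ⟨c'', rfl, by rw [hc'', hc', pow_succ', Equiv.Perm.mul_apply]⟩

theorem exists_length_eq (hn : 0 < n) (e : ℕ) : ∃ Γ : List (Fin n), Γ.length = e :=
  ⟨List.replicate e ⟨0, hn⟩, by simp⟩

theorem Table.of_imageCert (h : Table L ψ) {e d : ℕ} {c c' : Code n r}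
    (hc : ImageCert n e d (encodePairs L) c.toN c'.toN) :
    (ψ : Equiv.Perm (V n r)) c.val = c'.val := by
  refine eq_of_descend_eq e fun Γ hΓ => ?_
  have := hc _ (mem_words.2 ⟨Γ, hΓ, rfl⟩)
  rw [← Code.toN_app, ← Code.toN_app] at this
  obtain ⟨c₁, h₁, h₂⟩ := h.of_mem_step this
  rw [Code.toN_injective h₁, Code.val_app, Code.val_app] at h₂
  rw [h₂, (isHom_coe ψ).map_descend]

theorem Table.of_leavesCert (hn : 0 < n) (h : Table L ψ) {e d k : ℕ} {B : List (Code n r)}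
    {X : Set (V n r)} (hX : IsCut X) (hB : ∀ c : Code n r, c.val ∈ ASpan X ↔ c ∉ B)
    {c : Code n r}
    (hc : LeavesCert n e d k (encodePairs L) (B.map Code.toN) c.toN) :
    ¬ Stays (ψ : Equiv.Perm (V n r)) (ASpan X) c.val := by
  intro hs
  obtain ⟨i, -, _, hΓ₁, _, hΓ₂, q₁, hq₁, q₂, hq₂, hq⟩ := hc
  obtain ⟨Γ₁, -, rfl⟩ := mem_words.1 hΓ₁
  obtain ⟨Γ₂, -, rfl⟩ := mem_words.1 hΓ₂
  obtain ⟨p, hp⟩ := mem_ASpan_generators.1 (hX.span_subset (hs i))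
  have key : ∀ (Γ : List (Fin n)) (q : NCode),
      q ∈ reach n d (encodePairs L) i (c.toN.app (Γ.map Fin.val)) →
        q = p.toN.app (Γ.map Fin.val) := by
    intro Γ q hq
    rw [← Code.toN_app] at hq ⊢
    obtain ⟨c', rfl, hc'⟩ := h.of_mem_reach hq
    rw [Code.val_app, (isHom_pow ψ i).map_descend, ← hp, ← Code.val_app] at hc'
    rw [Code.val_injective hn hc']
  obtain rfl := key _ _ hq₁
  obtain rfl := key _ _ hq₂
  have hmem : p.2.map Fin.val ∈ shortWords n (p.toN.app (Γ₁.map Fin.val)).2.length :=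
    mem_shortWords.2 ⟨p.2, by simp [Code.toN], rfl⟩
  obtain h₁ | h₁ | h₁ := hq _ hmem
  · rw [List.mem_map] at h₁
    obtain ⟨b, hb, hbp⟩ := h₁
    rw [Code.toN_injective (a₁ := b) (a₂ := p) hbp] at hb
    exact (hB p).1 (hp ▸ hs i) hb
  · exact h₁ rfl
  · exact h₁ rfl

theorem Table.of_stayCert (h : Table L ψ) {e d : ℕ} {B : List (Code n r)}
    {X : Set (V n r)} (hB : ∀ c : Code n r, c.val ∈ ASpan X ↔ c ∉ B)
    {O : List (NCode × NCode × List ℕ)}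
    (hO : StayCert n r e d (encodePairs L) (B.map Code.toN) O) {c : Code n r}
    (hc : c.toN ∈ O.map Prod.fst) : Stays (ψ : Equiv.Perm (V n r)) (ASpan X) c.val := by
  intro k
  suffices H : ∀ (c : Code n r) (Γ : List (Fin n)), c.toN ∈ O.map Prod.fst →
      ((ψ : Equiv.Perm (V n r)) ^ k) (descend c.val Γ) ∈ ASpan X from H c [] hc
  clear hc c
  induction k with
  | zero =>
    intro c Γ hc
    obtain ⟨o, ho, hoc⟩ := List.mem_map.1 hc
    have h₁ := (hO o ho).2.1
    rw [hoc, List.mem_map_of_injective Code.toN_injective] at h₁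
    exact descend_mem_ASpan ((hB c).2 h₁) Γ
  | succ k ih =>
    intro c Γ hc
    obtain ⟨o, ho, hoc⟩ := List.mem_map.1 hc
    obtain ⟨-, -, hv, hi, hm⟩ := hO o ho
    obtain ⟨o', ho', ho''⟩ := List.mem_map.1 hm
    obtain ⟨c₁, hc₁⟩ := NCode.valid_iff.1 (hO o' ho').1
    obtain ⟨c₂, hc₂⟩ := NCode.valid_iff.1 hv
    rw [hoc, ← hc₂] at hi
    rw [← ho'', ← hc₁] at hc₂
    obtain ⟨E, -, rfl⟩ := Code.exists_app_of_toN_eq hc₂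
    rw [pow_succ, Equiv.Perm.mul_apply, (isHom_coe ψ).map_descend, h.of_imageCert hi,
      Code.val_app, ← descend_append]
    exact ih c₁ _ (by rw [hc₁, ho'']; exact hm)

theorem mem_expandList {X : Set (V n r)} {Y : List NCode} (hn : 0 < n)
    (hY : ∀ q, q ∈ Y ↔ ∃ c : Code n r, c.toN = q ∧ c.val ∈ X) (b : Code n r) (q : NCode) :
    q ∈ expandList n b.toN Y ↔ ∃ c : Code n r, c.toN = q ∧ c.val ∈ expandAt X b.val := by
  have hchild : ∀ j : Fin n, alpha j b.val = (b.app [j]).val := fun j => by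
    rw [Code.val_app]; rfl
  rw [expandList, List.mem_append, List.mem_filter, hY, List.mem_map]
  simp only [List.mem_range, decide_eq_true_eq, expandAt, Set.mem_union, Set.mem_sdiff,
    Set.mem_singleton_iff, Set.mem_range]
  constructor
  · rintro (⟨⟨c, rfl, hc⟩, hne⟩ | ⟨j, hj, rfl⟩)
    · exact ⟨c, rfl, .inl ⟨hc, fun h => hne (congrArg _ (Code.val_injective hn h))⟩⟩
    · exact ⟨b.app [⟨j, hj⟩], Code.toN_app _ _, .inr ⟨⟨j, hj⟩, hchild _⟩⟩
  · rintro ⟨c, rfl, ⟨hc, hne⟩ | ⟨j, hj⟩⟩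
    · exact .inl ⟨⟨c, rfl, hc⟩, fun h => hne (congrArg _ (Code.toN_injective h))⟩
    · refine .inr ⟨j, j.2, ?_⟩
      rw [hchild] at hj
      rw [← Code.val_injective hn hj, Code.toN_app]
      rfl

theorem Greedy.mem_frontier (hn : 0 < n) {σ : Equiv.Perm (V n r)} {B : List (Code n r)}
    {X : Set (V n r)} (h : Greedy σ B X) (q : NCode) :
    q ∈ frontier n r (B.map Code.toN) ↔ ∃ c : Code n r, c.toN = q ∧ c.val ∈ X := by
  induction h generalizing q with
  | nil =>
    simp only [frontier, List.map_nil, List.foldr_nil, List.mem_map, List.mem_range]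
    constructor
    · rintro ⟨i, hi, rfl⟩
      exact ⟨(⟨i, hi⟩, []), rfl, ⟨i, hi⟩, (Code.val_eq (⟨i, hi⟩, [])).symm⟩
    · rintro ⟨c, rfl, i, hi⟩
      have : Code.val (i, []) = c.val := by rw [Code.val_eq]; exact hi
      rw [← Code.val_injective hn this]
      exact ⟨i, i.2, rfl⟩
  | cons b _ _ _ ih => exact mem_expandList hn ih b q

theorem Greedy.nodup_frontier (hn : 0 < n) {σ : Equiv.Perm (V n r)} {B : List (Code n r)}
    {X : Set (V n r)} (h : Greedy σ B X) : (frontier n r (B.map Code.toN)).Nodup := by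
  induction h with
  | nil => exact List.nodup_range.map fun i j h => (Prod.mk.inj h).1
  | cons b h hb _ ih =>
    refine List.Nodup.append (ih.filter _) (List.nodup_range.map fun i j h => ?_) ?_
    · simpa using (Prod.mk.inj h).2
    · intro q hq hq'
      obtain ⟨j, hj, rfl⟩ := List.mem_map.1 hq'
      obtain ⟨c, hc, hcX⟩ := (h.mem_frontier hn _).1 (List.mem_filter.1 hq).1
      obtain ⟨E, hE, rfl⟩ := Code.exists_app_of_toN_eq hc
      rw [Code.val_app] at hcX
      obtain rfl := (h.isABasis.isCut hn).antichain _ hb _ hcX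
      simp at hE

theorem Table.of_greedyCert (hn : 0 < n) (h : Table L ψ) {e d k : ℕ} {B : List NCode}
    (hB : GreedyCert n r e d k (encodePairs L) B) :
    ∃ (B' : List (Code n r)) (X : Set (V n r)), B'.map Code.toN = B ∧
      Greedy (ψ : Equiv.Perm (V n r)) B' X := by
  induction B with
  | nil => exact ⟨[], _, rfl, .nil⟩
  | cons b B ih =>
    obtain ⟨hB, hb, hl, hl'⟩ := hB
    obtain ⟨B', X, rfl, hX⟩ := ih hB
    obtain ⟨c, rfl, hc⟩ := (hX.mem_frontier hn b).1 hb
    have hcut := hX.isABasis.isCut hn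
    rw [← encodePairs_swap] at hl'
    exact ⟨c :: B', _, rfl, hX.cons c hc
      ⟨h.of_leavesCert hn hcut (fun c => hX.mem_ASpan hn) hl,
        h.swap.of_leavesCert hn hcut (fun c => hX.mem_ASpan hn) hl'⟩⟩

theorem Table.of_check (hn : 0 < n) (h : Table L ψ) {z : Cert}
    (hz : Check n r (encodePairs L) z) :
    ∃ (B : List (Code n r)) (X : Set (V n r)), B.map Code.toN = z.2.1 ∧
      Greedy (ψ : Equiv.Perm (V n r)) B X ∧ IsSemiNormal ψ X := by
  obtain ⟨h₁, h₂, h₃, h₄⟩ := hz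
  obtain ⟨B, X, hB, hX⟩ := h.of_greedyCert hn h₁
  refine ⟨B, X, hB, hX, isSemiNormal_iff.2 ⟨hX.isABasis, ?_⟩⟩
  rw [← hB] at h₂ h₃ h₄
  rw [← encodePairs_swap] at h₃
  rintro _ ⟨x, hx, Γ, rfl⟩ ⟨hl, hl'⟩
  obtain ⟨c, rfl⟩ := mem_ASpan_generators.1 ((hX.isABasis.isCut hn).subset hx)
  obtain hc | hc := h₄ c.toN ((hX.mem_frontier hn _).2 ⟨c, rfl, hx⟩)
  · exact hl ((h.of_stayCert (fun c => hX.mem_ASpan hn) h₂ hc).descend Γ)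
  · exact hl' ((h.swap.of_stayCert (fun c => hX.mem_ASpan hn) h₃ hc).descend Γ)

/-! ### The existence of certificates -/

theorem Table.eventually_step (h : Table L ψ) (v : V n r) :
    ∀ᶠ e in atTop, ∀ᶠ d in atTop, ∀ Γ : List (Fin n), Γ.length = e →
      ∃ c c' : Code n r, c.val = descend v Γ ∧ c'.val = (ψ : Equiv.Perm (V n r)) (descend v Γ) ∧
        c'.toN ∈ step n d (encodePairs L) c.toN := by
  obtain ⟨e₀, he₀⟩ := h.exists_eval v
  filter_upwards [eventually_ge_atTop e₀] with e he
  refine (eventually_all_finite (List.finite_length_eq (Fin n) e)).2 fun Γ hΓ => ?_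
  obtain ⟨p, hp, Δ, c, c', hc, hc', hv⟩ := he₀ Γ (he.trans (le_of_eq hΓ.symm))
  filter_upwards [eventually_ge_atTop Δ.length] with d hd
  refine ⟨c, c', hv, ?_, ?_⟩
  · rw [← Word.eval_sound hc', ← hv, ← Word.eval_sound hc, (isHom_coe ψ).map_descend,
      h.map_eq p hp]
  · simp only [step, encodePairs, List.mem_flatMap, List.mem_map, List.mem_filterMap,
      mem_shortWords]
    refine ⟨_, ⟨p, hp, rfl⟩, _, ⟨Δ, hd, rfl⟩, ?_⟩
    rw [readCode_row, readCode_row, hc, hc']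
    exact if_pos rfl

theorem Table.eventually_imageCert (hn : 0 < n) (h : Table L ψ) {c c' : Code n r}
    (hc : (ψ : Equiv.Perm (V n r)) c.val = c'.val) :
    ∀ᶠ e in atTop, ∀ᶠ d in atTop, ImageCert n e d (encodePairs L) c.toN c'.toN := by
  filter_upwards [h.eventually_step c.val] with e he
  filter_upwards [he] with d hd Γ' hΓ'
  obtain ⟨Γ, hΓ, rfl⟩ := mem_words.1 hΓ'
  obtain ⟨c₁, c₂, h₁, h₂, h₃⟩ := hd Γ hΓ
  rw [(isHom_coe ψ).map_descend, hc, ← Code.val_app] at h₂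
  rw [← Code.val_app] at h₁
  rwa [Code.val_injective hn h₁, Code.val_injective hn h₂, Code.toN_app, Code.toN_app] at h₃

theorem Table.eventually_reach (hn : 0 < n) (h : Table L ψ) (c : Code n r) (k : ℕ) :
    ∀ᶠ e in atTop, ∀ᶠ d in atTop, ∀ Γ : List (Fin n), Γ.length = e →
      ∃ c' : Code n r, c'.val = ((ψ : Equiv.Perm (V n r)) ^ k) (descend c.val Γ) ∧
        c'.toN ∈ reach n d (encodePairs L) k (c.app Γ).toN := by
  induction k with
  | zero =>
    refine .of_forall fun e => .of_forall fun d Γ _ => ⟨c.app Γ, Code.val_app _ _, ?_⟩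
    simp [reach]
  | succ k ih =>
    filter_upwards [ih, h.eventually_step (((ψ : Equiv.Perm (V n r)) ^ k) c.val)] with e he he'
    filter_upwards [he, he'] with d hd hd' Γ hΓ
    obtain ⟨c₁, h₁, h₂⟩ := hd Γ hΓ
    obtain ⟨c₂, c₃, h₃, h₄, h₅⟩ := hd' Γ hΓ
    rw [(isHom_pow ψ k).map_descend] at h₁
    obtain rfl := Code.val_injective hn (h₁.trans h₃.symm)
    refine ⟨c₃, ?_, (reach_succ _ _ _ _ _).2 ⟨_, h₂, h₅⟩⟩
    rw [h₄, ← (isHom_pow ψ k).map_descend, pow_succ', Equiv.Perm.mul_apply]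

theorem Table.eventually_leavesCert (hn : 0 < n) (h : Table L ψ) {B : List (Code n r)}
    {X : Set (V n r)} (hB : ∀ c : Code n r, c.val ∈ ASpan X ↔ c ∉ B) {c : Code n r}
    (hc : ¬ Stays (ψ : Equiv.Perm (V n r)) (ASpan X) c.val) :
    ∀ᶠ k in atTop, ∀ᶠ e in atTop, ∀ᶠ d in atTop,
      LeavesCert n e d k (encodePairs L) (B.map Code.toN) c.toN := by
  obtain ⟨i, hi⟩ := not_forall.1 hc
  filter_upwards [eventually_ge_atTop i] with k hk
  filter_upwards [h.eventually_reach hn c i] with e he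
  filter_upwards [he] with d hd
  by_contra hcert
  obtain ⟨Γ₀, hΓ₀⟩ := exists_length_eq hn e
  obtain ⟨c₀, hc₀, hr₀⟩ := hd Γ₀ hΓ₀
  -- otherwise a code outside `B` is consistent with all descendants at depth `e`
  have key : ∀ Γ : List (Fin n), Γ.length = e → ∃ Δ : List (Fin n), (c₀.1, Δ) ∉ B ∧
      Δ ++ Γ₀ = c₀.2 ∧
      Code.val (c₀.1, Δ ++ Γ) = ((ψ : Equiv.Perm (V n r)) ^ i) (descend c.val Γ) := by
    intro Γ hΓ
    obtain ⟨c₁, hc₁, hr₁⟩ := hd Γ hΓ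
    by_contra hno
    rw [Code.toN_app] at hr₀ hr₁
    refine hcert ⟨i, List.mem_range.2 (by omega), _, mem_words.2 ⟨Γ₀, hΓ₀, rfl⟩, _,
      mem_words.2 ⟨Γ, hΓ, rfl⟩, _, hr₀, _, hr₁, fun Δ hΔ => ?_⟩
    obtain ⟨Δ, -, rfl⟩ := mem_shortWords.1 hΔ
    by_contra hΔ
    push Not at hΔ
    obtain ⟨h₁, h₂, h₃⟩ := hΔ
    refine hno ⟨Δ, fun hB => h₁ (List.mem_map.2 ⟨_, hB, rfl⟩), ?_, ?_⟩
    · have : Code.toN (c₀.1, Δ ++ Γ₀) = c₀.toN := by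
        rw [← h₂]; simp [Code.toN]
      exact congrArg Prod.snd (Code.toN_injective this)
    · have : Code.toN (c₀.1, Δ ++ Γ) = c₁.toN := by
        rw [← h₃]; simp [Code.toN]
      rw [Code.toN_injective this, hc₁]
  obtain ⟨Δ, hΔB, hΔ, -⟩ := key Γ₀ hΓ₀
  have : Code.val (c₀.1, Δ) = ((ψ : Equiv.Perm (V n r)) ^ i) c.val := by
    refine eq_of_descend_eq e fun Γ hΓ => ?_
    obtain ⟨Δ', -, hΔ', hv⟩ := key Γ hΓ
    rw [← hΔ] at hΔ'
    rw [List.append_cancel_right hΔ'] at hv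
    rw [← Code.val_app, ← (isHom_pow ψ i).map_descend]
    exact hv
  exact hi (this ▸ (hB _).2 hΔB)

theorem Greedy.eventually_greedyCert (hn : 0 < n) (h : Table L ψ) {B : List (Code n r)}
    {X : Set (V n r)} (hB : Greedy (ψ : Equiv.Perm (V n r)) B X) :
    ∀ᶠ k in atTop, ∀ᶠ e in atTop, ∀ᶠ d in atTop,
      GreedyCert n r e d k (encodePairs L) (B.map Code.toN) := by
  induction hB with
  | nil => exact .of_forall fun _ => .of_forall fun _ => .of_forall fun _ => trivial
  | cons c hX hc hl ih =>
    filter_upwards [ih, h.eventually_leavesCert hn (fun c => hX.mem_ASpan hn) hl.1,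
      h.swap.eventually_leavesCert hn (fun c => hX.mem_ASpan hn) hl.2] with k h₁ h₂ h₃
    filter_upwards [h₁, h₂, h₃] with e h₁ h₂ h₃
    filter_upwards [h₁, h₂, h₃] with d h₁ h₂ h₃
    exact ⟨h₁, (hX.mem_frontier hn _).2 ⟨c, rfl, hc⟩, h₂, by rwa [← encodePairs_swap]⟩

/-- In a semi-normal form, an element of `X` with a forward orbit inside `X⟨A⟩` has a later image
below an element of `X` of the same kind. Otherwise all its images would be of the form `y Δ` with
`y ∈ X` having a backward orbit inside `X⟨A⟩`; going back to `x ∈ X` shows that `Δ` is empty,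
so that the orbit stays in the finite set `X` and returns to `x`. -/
theorem exists_pow_eq_descend {σ : G n r} {X : Set (V n r)} (hX : IsCut X)
    (hs : ∀ x ∈ X, Stays (σ : Equiv.Perm (V n r)) (ASpan X) x ∨
      Stays (σ : Equiv.Perm (V n r))⁻¹ (ASpan X) x) {x : V n r} (hx : x ∈ X)
    (hxs : Stays (σ : Equiv.Perm (V n r)) (ASpan X) x) :
    ∃ k, 0 < k ∧ ∃ y ∈ X, Stays (σ : Equiv.Perm (V n r)) (ASpan X) y ∧ ∃ E,
      ((σ : Equiv.Perm (V n r)) ^ k) x = descend y E := by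
  by_contra hno
  push Not at hno
  have hmem : ∀ k : ℕ, ((σ : Equiv.Perm (V n r)) ^ (k + 1)) x ∈ X := by
    intro k
    obtain ⟨y, hy, E, hyE⟩ := hxs (k + 1)
    have hyb := (hs y hy).resolve_left fun h => hno _ k.succ_pos y hy h E hyE
    obtain ⟨z, hz, Δ, hzΔ⟩ := hyb (k + 1)
    have hxz : x = descend z (Δ ++ E) := by
      have h₁ := (isHom_pow σ⁻¹ (k + 1)).map_descend y E
      rw [descend_append, ← hzΔ]
      refine Eq.trans ?_ h₁
      rw [← hyE, InvMemClass.coe_inv, inv_pow, Equiv.Perm.coe_inv, Equiv.symm_apply_apply]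
    have hnil := hX.antichain z hz _ (hxz ▸ hx)
    rw [List.append_eq_nil_iff] at hnil
    rw [hyE, hnil.2]
    exact hy
  obtain ⟨i, j, hij, heq⟩ : ∃ i j : ℕ, i < j ∧
      ((σ : Equiv.Perm (V n r)) ^ (i + 1)) x = ((σ : Equiv.Perm (V n r)) ^ (j + 1)) x := by
    obtain ⟨i, -, j, -, hij, heq⟩ := Set.infinite_univ.exists_ne_map_eq_of_mapsTo
      (f := fun k : ℕ => ((σ : Equiv.Perm (V n r)) ^ (k + 1)) x) (t := X)
      (fun k _ => hmem k) hX.finite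
    obtain hlt | hlt := lt_or_gt_of_ne hij
    · exact ⟨i, j, hlt, heq⟩
    · exact ⟨j, i, hlt, heq.symm⟩
  refine hno (j - i) (by omega) x hx hxs [] ?_
  rw [show j + 1 = (i + 1) + (j - i) by omega, pow_add _ (i + 1), Equiv.Perm.mul_apply] at heq
  exact (Equiv.injective _ heq).symm

theorem Table.eventually_exists_stayCert (hn : 0 < n) (h : Table L ψ) {B : List (Code n r)}
    {X : Set (V n r)} (hX : IsCut X) (hB : ∀ c : Code n r, c.val ∈ ASpan X ↔ c ∉ B)
    (hs : ∀ x ∈ X, Stays (ψ : Equiv.Perm (V n r)) (ASpan X) x ∨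
      Stays (ψ : Equiv.Perm (V n r))⁻¹ (ASpan X) x) :
    ∃ O, (∀ᶠ e in atTop, ∀ᶠ d in atTop,
        StayCert n r e d (encodePairs L) (B.map Code.toN) O) ∧
      ∀ c : Code n r, c.val ∈ X → Stays (ψ : Equiv.Perm (V n r)) (ASpan X) c.val →
        c.toN ∈ O.map Prod.fst := by
  set σ : Equiv.Perm (V n r) := ψ.1
  have hk : ∀ x, ∃ k, x ∈ X → Stays σ (ASpan X) x → 0 < k ∧ ∃ y ∈ X, Stays σ (ASpan X) y ∧
      ∃ E, (σ ^ k) x = descend y E := by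
    intro x
    by_cases hx : x ∈ X ∧ Stays σ (ASpan X) x
    · obtain ⟨k, hk⟩ := exists_pow_eq_descend hX hs hx.1 hx.2
      exact ⟨k, fun _ _ => hk⟩
    · exact ⟨0, fun h₁ h₂ => absurd ⟨h₁, h₂⟩ hx⟩
  choose k hk using hk
  -- the finite stretches of orbits from `X` to the next image below `X`
  let O : Set (Code n r) := {c | ∃ x ∈ X, Stays σ (ASpan X) x ∧ ∃ i < k x, c.val = (σ ^ i) x}
  have hOX : ∀ c : Code n r, c.val ∈ X → Stays σ (ASpan X) c.val → c ∈ O := fun c hc hcs =>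
    ⟨c.val, hc, hcs, 0, (hk _ hc hcs).1, rfl⟩
  have hOfin : O.Finite := by
    refine Set.Finite.of_finite_image (f := Code.val) ?_ (Code.val_injective hn).injOn
    refine (hX.finite.biUnion fun x _ =>
      (Set.finite_Iio (k x)).image fun i => (σ ^ i) x).subset ?_
    rintro _ ⟨c, ⟨x, hx, -, i, hi, hc⟩, rfl⟩
    exact Set.mem_biUnion hx ⟨i, hi, hc.symm⟩
  have hnext : ∀ c, ∃ oE : Code n r × List (Fin n),
      c ∈ O → oE.1 ∈ O ∧ σ c.val = (oE.1.app oE.2).val := by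
    intro c
    by_cases hc : c ∈ O
    · obtain ⟨x, hx, hxs, i, hi, hcx⟩ := hc
      have hσ : σ c.val = (σ ^ (i + 1)) x := by rw [hcx, pow_succ', Equiv.Perm.mul_apply]
      by_cases hik : i + 1 < k x
      · obtain ⟨o, ho⟩ := mem_ASpan_generators.1 (hX.span_subset (hxs (i + 1)))
        exact ⟨(o, []), fun _ => ⟨⟨x, hx, hxs, i + 1, hik, ho⟩, by
          rw [hσ, Code.val_app, ho]; rfl⟩⟩
      · obtain ⟨-, y, hy, hys, E, hE⟩ := hk x hx hxs
        obtain ⟨o, rfl⟩ := mem_ASpan_generators.1 (hX.subset hy)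
        refine ⟨(o, E), fun _ => ⟨hOX o hy hys, ?_⟩⟩
        rw [hσ, show i + 1 = k x by omega, hE, Code.val_app]
    · exact ⟨(c, []), fun h => absurd h hc⟩
  choose f hf using hnext
  let T : List (NCode × NCode × List ℕ) := hOfin.toFinset.toList.map fun c =>
    (c.toN, (f c).1.toN, (f c).2.map Fin.val)
  have hT : ∀ c ∈ O, c.toN ∈ T.map Prod.fst := fun c hc => by
    refine List.mem_map.2 ⟨_, List.mem_map.2 ⟨c, ?_, rfl⟩, rfl⟩
    simpa using hc
  refine ⟨T, ?_, fun c hc hcs => hT c (hOX c hc hcs)⟩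
  have hev : ∀ c ∈ O, ∀ᶠ e in atTop, ∀ᶠ d in atTop,
      ImageCert n e d (encodePairs L) c.toN ((f c).1.app (f c).2).toN := fun c hc =>
    h.eventually_imageCert hn (hf c hc).2
  filter_upwards [(eventually_all_finite hOfin).2 hev] with e he
  filter_upwards [(eventually_all_finite hOfin).2 he] with d hd o ho
  obtain ⟨c, hc, rfl⟩ := List.mem_map.1 ho
  have hcO : c ∈ O := by simpa using hc
  have hic := hd c hcO
  rw [Code.toN_app] at hic
  refine ⟨NCode.valid_iff.2 ⟨c, rfl⟩, ?_, NCode.valid_iff.2 ⟨_, Code.toN_app _ _⟩, hic,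
    hT _ (hf c hcO).1⟩
  rw [List.mem_map_of_injective Code.toN_injective, ← hB]
  obtain ⟨x, hx, hxs, i, -, hcx⟩ := hcO
  exact hcx ▸ hxs i

theorem Table.exists_check (hn : 0 < n) (h : Table L ψ) : ∃ z, Check n r (encodePairs L) z := by
  obtain ⟨B, X, hB, hX⟩ := exists_greedy_isSemiNormal hn ψ
  have hcut := hX.1.isCut hn
  have hs : ∀ x ∈ X, Stays (ψ : Equiv.Perm (V n r)) (ASpan X) x ∨
      Stays (ψ : Equiv.Perm (V n r))⁻¹ (ASpan X) x := by
    intro x hx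
    have := (isSemiNormal_iff.1 hX).2 x (subset_ASpan X hx)
    rw [Leaves] at this
    tauto
  obtain ⟨O₁, hO₁, hX₁⟩ := h.eventually_exists_stayCert hn hcut (fun c => hB.mem_ASpan hn) hs
  obtain ⟨O₂, hO₂, hX₂⟩ := h.swap.eventually_exists_stayCert hn hcut
    (fun c => hB.mem_ASpan hn) (fun x hx => by
      rw [InvMemClass.coe_inv, inv_inv]
      exact (hs x hx).symm)
  obtain ⟨k, hk⟩ := (hB.eventually_greedyCert hn h).exists
  obtain ⟨e, he⟩ := (hk.and (hO₁.and hO₂)).exists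
  obtain ⟨d, h₁, h₂, h₃⟩ := (he.1.and (he.2.1.and he.2.2)).exists
  rw [encodePairs_swap] at h₃
  refine ⟨((e, d, k), B.map Code.toN, O₁, O₂), h₁, h₂, h₃, fun x hx => ?_⟩
  obtain ⟨c, rfl, hc⟩ := (hB.mem_frontier hn x).1 hx
  exact (hs _ hc).imp (hX₁ c hc) (hX₂ c hc)

end

/-! ### The check of certificates is primitive recursive -/

section
variable {α β : Type*} [Primcodable α] [Primcodable β]

theorem primrecPred_exists_mem {f : α → List β} {p : α → β → Prop} (hf : Primrec f)
    (hp : PrimrecPred fun x : α × β => p x.1 x.2) : PrimrecPred fun a => ∃ b ∈ f a, p a b :=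
  (PrimrecRel.exists_mem_list (R := fun b a => p a b)
    (hp.comp (Primrec.snd.pair Primrec.fst))).comp hf Primrec.id

theorem primrecPred_forall_mem {f : α → List β} {p : α → β → Prop} (hf : Primrec f)
    (hp : PrimrecPred fun x : α × β => p x.1 x.2) : PrimrecPred fun a => ∀ b ∈ f a, p a b :=
  (PrimrecRel.forall_mem_list (R := fun b a => p a b)
    (hp.comp (Primrec.snd.pair Primrec.fst))).comp hf Primrec.id

theorem primrecPred_eq {f g : α → β} (hf : Primrec f) (hg : Primrec g) :
    PrimrecPred fun a => f a = g a := Primrec.eq.comp hf hg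

theorem primrecPred_mem {f : α → β} {g : α → List β} (hf : Primrec f) (hg : Primrec g) :
    PrimrecPred fun a => f a ∈ g a :=
  (primrecPred_exists_mem hg (p := fun a b => b = f a)
    (primrecPred_eq Primrec.snd (hf.comp Primrec.fst))).of_eq fun a => by simp

theorem primrec_readLetter {fn : α → ℕ} {fl : α → Letter} {fs : α → ReadState}
    (hn : Primrec fn) (hl : Primrec fl) (hs : Primrec fs) :
    Primrec fun a => readLetter (fn a) (fl a) (fs a) := by
  have h : Primrec fun a => (Sum.casesOn (fs a) (fun res => Sum.inl res)
      fun s => Nat.casesOn s.1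
        (Sum.casesOn (fl a) (fun i => Sum.inl (some (i, s.2)))
          fun o => Option.casesOn o
            (List.casesOn s.2 (Sum.inl none) fun j Γ => Sum.inr (fn a - 1 - j, Γ))
            fun j => Sum.inr (0, j :: s.2))
        fun k => Sum.casesOn (fl a) (fun _ => Sum.inr (k, s.2))
          fun o => Option.casesOn o (Sum.inr (k + fn a, s.2))
            fun _ => Sum.inr (k + 1, s.2) : ReadState) := by
    open Primrec in
    refine sumCasesOn hs (Primrec.sumInl.comp snd).to₂ ?_
    change Primrec fun _ => _
    refine nat_casesOn (fst.comp snd) ?_ ?_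
    · refine sumCasesOn (hl.comp fst) ?_ ?_ <;> change Primrec fun _ => _
      · exact sumInl.comp (option_some.comp (snd.pair (snd.comp (snd.comp fst))))
      · refine option_casesOn snd ?_ ?_
        · refine list_casesOn (σ := ReadState) (f := fun x : (α × ℕ × List ℕ) × Option ℕ => x.1.2.2)
            (h := fun x y => Sum.inr (fn x.1.1 - 1 - y.1, y.2)) (snd.comp (snd.comp fst))
            (const (Sum.inl none)) ?_
          change Primrec fun _ => _
          exact sumInr.comp ((nat_sub.comp (nat_sub.comp (hn.comp (fst.comp (fst.comp fst)))
            (const 1)) (fst.comp snd)).pair (snd.comp snd))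
        · change Primrec fun _ => _
          exact sumInr.comp ((const 0).pair
            (list_cons.comp snd (snd.comp (snd.comp (fst.comp fst)))))
    · change Primrec fun _ => _
      refine sumCasesOn (hl.comp (fst.comp fst)) ?_ ?_ <;> change Primrec fun _ => _
      · exact sumInr.comp ((snd.comp fst).pair (snd.comp (snd.comp (fst.comp fst))))
      · refine option_casesOn snd ?_ ?_
        · exact sumInr.comp ((nat_add.comp (snd.comp fst) (hn.comp (fst.comp (fst.comp fst)))).pair
            (snd.comp (snd.comp (fst.comp fst))))
        · change Primrec fun _ => _
          exact sumInr.comp ((succ.comp (snd.comp (fst.comp fst))).pair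
            (snd.comp (snd.comp (fst.comp (fst.comp fst)))))
  refine h.of_eq fun a => ?_
  rcases fs a with _ | ⟨_ | k, _ | ⟨j, Γ⟩⟩ <;> rcases fl a with _ | _ | _ <;> rfl

theorem primrec_readCode {fn : α → ℕ} {fw : α → List Letter} {fΓ : α → List ℕ}
    (hn : Primrec fn) (hw : Primrec fw) (hΓ : Primrec fΓ) :
    Primrec fun a => readCode (fn a) (fw a) (fΓ a) := by
  have h := Primrec.list_foldr (σ := ReadState) hw
    (Primrec.sumInr.comp ((Primrec.const 0).pair hΓ))
    (h := fun a x => readLetter (fn a) x.1 x.2)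
    (primrec_readLetter (hn.comp Primrec.fst) (Primrec.fst.comp Primrec.snd)
      (Primrec.snd.comp Primrec.snd)).to₂
  have h' : Primrec fun a => (Sum.casesOn
      ((fw a).foldr (fun l s => readLetter (fn a) l s) (.inr (0, fΓ a)))
      (fun res => res) fun _ => none : Option NCode) :=
    Primrec.sumCasesOn h Primrec.snd.to₂ (Primrec.const none).to₂
  refine h'.of_eq fun a => ?_
  rw [readCode]
  rcases (fw a).foldr (readLetter (fn a)) (.inr (0, fΓ a)) with _ | _ <;> rfl

theorem primrec_words {fn fd : α → ℕ} (hn : Primrec fn) (hd : Primrec fd) :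
    Primrec fun a => words (fn a) (fd a) := by
  have h := Primrec.nat_rec' (β := List (List ℕ)) hd (Primrec.const [[]])
    (h := fun a x => x.2.flatMap fun Γ => (List.range (fn a)).map fun j => j :: Γ)
    (Primrec.list_flatMap (Primrec.snd.comp Primrec.snd)
      (Primrec.list_map (Primrec.list_range.comp (hn.comp (Primrec.fst.comp Primrec.fst)))
        (Primrec.list_cons.comp Primrec.snd (Primrec.snd.comp Primrec.fst)).to₂).to₂).to₂
  refine h.of_eq fun a => ?_
  induction fd a with
  | zero => rfl
  | succ d ih => rw [words, ← ih]

theorem primrec_shortWords {fn fd : α → ℕ} (hn : Primrec fn) (hd : Primrec fd) :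
    Primrec fun a => shortWords (fn a) (fd a) :=
  Primrec.list_flatMap (Primrec.list_range.comp (Primrec.succ.comp hd))
    (primrec_words (hn.comp Primrec.fst) Primrec.snd).to₂

theorem primrec_step {fn fd : α → ℕ} {fL : α → Rows} {fp : α → NCode} (hn : Primrec fn)
    (hd : Primrec fd) (hL : Primrec fL) (hp : Primrec fp) :
    Primrec fun a => step (fn a) (fd a) (fL a) (fp a) := by
  open Primrec in
  refine list_flatMap hL ?_
  change Primrec fun _ => _
  refine listFilterMap (primrec_shortWords (hn.comp fst) (hd.comp fst)) ?_
  change Primrec fun _ => _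
  refine Primrec.ite (primrecPred_eq (primrec_readCode (hn.comp (fst.comp fst))
    (fst.comp (snd.comp fst)) snd) (option_some.comp (hp.comp (fst.comp fst)))) ?_ (const none)
  exact primrec_readCode (hn.comp (fst.comp fst)) (snd.comp (snd.comp fst)) snd

theorem primrec_reach {fn fd fk : α → ℕ} {fL : α → Rows} {fp : α → NCode} (hn : Primrec fn)
    (hd : Primrec fd) (hL : Primrec fL) (hk : Primrec fk) (hp : Primrec fp) :
    Primrec fun a => reach (fn a) (fd a) (fL a) (fk a) (fp a) := by
  open Primrec in
  refine nat_iterate hk (list_cons.comp hp (const [])) ?_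
  change Primrec fun _ => _
  exact list_flatMap snd (primrec_step (hn.comp (fst.comp fst)) (hd.comp (fst.comp fst))
    (hL.comp (fst.comp fst)) snd).to₂

theorem primrec_app {fc : α → NCode} {fΓ : α → List ℕ} (hc : Primrec fc) (hΓ : Primrec fΓ) :
    Primrec fun a => (fc a).app (fΓ a) :=
  (Primrec.fst.comp hc).pair (Primrec.list_append.comp (Primrec.snd.comp hc) hΓ)

theorem primrecPred_imageCert {fn fe fd : α → ℕ} {fL : α → Rows} {fc fc' : α → NCode}
    (hn : Primrec fn) (he : Primrec fe) (hd : Primrec fd) (hL : Primrec fL) (hc : Primrec fc)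
    (hc' : Primrec fc') :
    PrimrecPred fun a => ImageCert (fn a) (fe a) (fd a) (fL a) (fc a) (fc' a) := by
  open Primrec in
  refine primrecPred_forall_mem (primrec_words hn he) ?_
  exact primrecPred_mem (primrec_app (hc'.comp fst) snd) (primrec_step (hn.comp fst)
    (hd.comp fst) (hL.comp fst) (primrec_app (hc.comp fst) snd))

theorem primrecPred_leavesCert {fn fe fd fk : α → ℕ} {fL : α → Rows} {fB : α → List NCode}
    {fb : α → NCode} (hn : Primrec fn) (he : Primrec fe) (hd : Primrec fd) (hk : Primrec fk)
    (hL : Primrec fL) (hB : Primrec fB) (hb : Primrec fb) :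
    PrimrecPred fun a =>
      LeavesCert (fn a) (fe a) (fd a) (fk a) (fL a) (fB a) (fb a) := by
  open Primrec in
  refine primrecPred_exists_mem (list_range.comp (succ.comp hk)) ?_
  refine primrecPred_exists_mem (primrec_words (hn.comp fst) (he.comp fst)) ?_
  refine primrecPred_exists_mem (primrec_words (hn.comp (fst.comp fst))
    (he.comp (fst.comp fst))) ?_
  refine primrecPred_exists_mem (primrec_reach (hn.comp (fst.comp (fst.comp fst)))
    (hd.comp (fst.comp (fst.comp fst))) (hL.comp (fst.comp (fst.comp fst)))
    (snd.comp (fst.comp fst)) (primrec_app (hb.comp (fst.comp (fst.comp fst)))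
    (snd.comp fst))) ?_
  refine primrecPred_exists_mem (primrec_reach (hn.comp (fst.comp (fst.comp (fst.comp fst))))
    (hd.comp (fst.comp (fst.comp (fst.comp fst)))) (hL.comp (fst.comp (fst.comp (fst.comp fst))))
    (snd.comp (fst.comp (fst.comp fst)))
    (primrec_app (hb.comp (fst.comp (fst.comp (fst.comp fst)))) (snd.comp fst))) ?_
  have hq₁ : Primrec fun x : ((((α × ℕ) × List ℕ) × List ℕ) × NCode) × NCode => x.1.2 :=
    snd.comp fst
  refine primrecPred_forall_mem (primrec_shortWords
    (hn.comp (fst.comp (fst.comp (fst.comp (fst.comp fst)))))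
    (list_length.comp (snd.comp hq₁))) ?_
  have hq₁' := hq₁.comp (fst (α := ((((α × ℕ) × List ℕ) × List ℕ) × NCode) × NCode)
    (β := List ℕ))
  refine (primrecPred_mem ((fst.comp hq₁').pair snd)
    (hB.comp (fst.comp (fst.comp (fst.comp (fst.comp (fst.comp fst))))))).or (PrimrecPred.or ?_ ?_)
  · exact (primrecPred_eq ((fst.comp hq₁').pair (list_append.comp snd
      (snd.comp (fst.comp (fst.comp (fst.comp fst)))))) hq₁').not
  · exact (primrecPred_eq ((fst.comp hq₁').pair (list_append.comp snd
      (snd.comp (fst.comp (fst.comp fst))))) (snd.comp fst)).not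

theorem primrecPred_valid {fn fr : α → ℕ} {fc : α → NCode} (hn : Primrec fn) (hr : Primrec fr)
    (hc : Primrec fc) : PrimrecPred fun a => (fc a).Valid (fn a) (fr a) := by
  open Primrec in
  exact (nat_lt.comp (fst.comp hc) hr).and
    (primrecPred_forall_mem (snd.comp hc) (nat_lt.comp snd (hn.comp fst)))

theorem primrecPred_stayCert {fn fr fe fd : α → ℕ} {fL : α → Rows} {fB : α → List NCode}
    {fO : α → List (NCode × NCode × List ℕ)} (hn : Primrec fn) (hr : Primrec fr)
    (he : Primrec fe) (hd : Primrec fd) (hL : Primrec fL) (hB : Primrec fB) (hO : Primrec fO) :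
    PrimrecPred fun a => StayCert (fn a) (fr a) (fe a) (fd a) (fL a) (fB a) (fO a) := by
  open Primrec in
  refine primrecPred_forall_mem hO ?_
  have h₁ : Primrec fun x : α × NCode × NCode × List ℕ => x.2.1 := fst.comp snd
  have h₂ : Primrec fun x : α × NCode × NCode × List ℕ => x.2.2.1 := fst.comp (snd.comp snd)
  have h₃ : Primrec fun x : α × NCode × NCode × List ℕ => x.2.2.1.app x.2.2.2 :=
    primrec_app h₂ (snd.comp (snd.comp snd))
  exact (primrecPred_valid (hn.comp fst) (hr.comp fst) h₁).and
    ((primrecPred_mem h₁ (hB.comp fst)).not.and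
    ((primrecPred_valid (hn.comp fst) (hr.comp fst) h₃).and
    ((primrecPred_imageCert (hn.comp fst) (he.comp fst) (hd.comp fst) (hL.comp fst) h₁ h₃).and
    (primrecPred_mem h₂ (list_map (hO.comp fst) (fst.comp snd).to₂)))))

theorem primrec_expandList {fn : α → ℕ} {fb : α → NCode} {fX : α → List NCode}
    (hn : Primrec fn) (hb : Primrec fb) (hX : Primrec fX) :
    Primrec fun a => expandList (fn a) (fb a) (fX a) := by
  open Primrec in
  refine list_append.comp ?_ (list_map (list_range.comp hn)
    (primrec_app (hb.comp fst) (list_cons.comp snd (const []))).to₂)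
  have h : PrimrecRel fun c b : NCode => c ≠ b := Primrec.eq.not
  exact h.listFilter.comp hX hb

theorem primrec_frontier {fn fr : α → ℕ} {fB : α → List NCode} (hn : Primrec fn)
    (hr : Primrec fr) (hB : Primrec fB) : Primrec fun a => frontier (fn a) (fr a) (fB a) := by
  open Primrec in
  exact list_foldr hB (list_map (list_range.comp hr) (snd.pair (const [])).to₂)
    (primrec_expandList (hn.comp fst) (fst.comp snd) (snd.comp snd)).to₂

theorem primrec_swap {fL : α → Rows} (hL : Primrec fL) :
    Primrec fun a => (fL a).map Prod.swap :=
  Primrec.list_map hL ((Primrec.snd.comp Primrec.snd).pair (Primrec.fst.comp Primrec.snd)).to₂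

theorem primrecPred_greedyCert {fn fr fe fd fk : α → ℕ} {fL : α → Rows} {fB : α → List NCode}
    (hn : Primrec fn) (hr : Primrec fr) (he : Primrec fe) (hd : Primrec fd) (hk : Primrec fk)
    (hL : Primrec fL) (hB : Primrec fB) :
    PrimrecPred fun a => GreedyCert (fn a) (fr a) (fe a) (fd a) (fk a) (fL a) (fB a) := by
  classical
  open Primrec in
  have hb : Primrec fun x : α × NCode × List NCode × Bool => x.2.1 := fst.comp snd
  have hB' : Primrec fun x : α × NCode × List NCode × Bool => x.2.2.1 :=
    fst.comp (snd.comp snd)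
  have hstep : PrimrecPred fun x : α × NCode × List NCode × Bool =>
      x.2.2.2 = true ∧ x.2.1 ∈ frontier (fn x.1) (fr x.1) x.2.2.1 ∧
        LeavesCert (fn x.1) (fe x.1) (fd x.1) (fk x.1) (fL x.1) x.2.2.1 x.2.1 ∧
        LeavesCert (fn x.1) (fe x.1) (fd x.1) (fk x.1) ((fL x.1).map Prod.swap) x.2.2.1 x.2.1 :=
    (primrecPred_eq (snd.comp (snd.comp snd)) (const true)).and
      ((primrecPred_mem hb (primrec_frontier (hn.comp fst) (hr.comp fst) hB')).and
      ((primrecPred_leavesCert (hn.comp fst) (he.comp fst) (hd.comp fst) (hk.comp fst)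
        (hL.comp fst) hB' hb).and
      (primrecPred_leavesCert (hn.comp fst) (he.comp fst) (hd.comp fst) (hk.comp fst)
        (primrec_swap (hL.comp fst)) hB' hb)))
  have h := list_rec hB (const true) hstep.decide.to₂
  refine Primrec.primrecPred (h.of_eq fun a => ?_)
  induction fB a with
  | nil => exact (decide_eq_true (p := GreedyCert _ _ _ _ _ _ []) trivial).symm
  | cons b B ih => simp only [ih, GreedyCert, decide_eq_true_eq]; congr

theorem primrecPred_check : PrimrecPred fun x : (ℕ × ℕ × Rows) × Cert =>
    Check x.1.1 x.1.2.1 x.1.2.2 x.2 := by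
  open Primrec in
  have hn : Primrec fun x : (ℕ × ℕ × Rows) × Cert => x.1.1 := fst.comp fst
  have hr : Primrec fun x : (ℕ × ℕ × Rows) × Cert => x.1.2.1 := fst.comp (snd.comp fst)
  have hL : Primrec fun x : (ℕ × ℕ × Rows) × Cert => x.1.2.2 := snd.comp (snd.comp fst)
  have he : Primrec fun x : (ℕ × ℕ × Rows) × Cert => x.2.1.1 := fst.comp (fst.comp snd)
  have hd : Primrec fun x : (ℕ × ℕ × Rows) × Cert => x.2.1.2.1 :=
    fst.comp (snd.comp (fst.comp snd))
  have hk : Primrec fun x : (ℕ × ℕ × Rows) × Cert => x.2.1.2.2 :=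
    snd.comp (snd.comp (fst.comp snd))
  have hB : Primrec fun x : (ℕ × ℕ × Rows) × Cert => x.2.2.1 := fst.comp (snd.comp snd)
  have hO₁ : Primrec fun x : (ℕ × ℕ × Rows) × Cert => x.2.2.2.1 :=
    fst.comp (snd.comp (snd.comp snd))
  have hO₂ : Primrec fun x : (ℕ × ℕ × Rows) × Cert => x.2.2.2.2 :=
    snd.comp (snd.comp (snd.comp snd))
  exact (primrecPred_greedyCert hn hr he hd hk hL hB).and
    ((primrecPred_stayCert hn hr he hd hL hB hO₁).and
    ((primrecPred_stayCert hn hr he hd (primrec_swap hL) hB hO₂).and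
    (primrecPred_forall_mem (primrec_frontier hn hr hB)
      ((primrecPred_mem snd (list_map (hO₁.comp fst) (fst.comp snd).to₂)).or
        (primrecPred_mem snd (list_map (hO₂.comp fst) (fst.comp snd).to₂))))))

end

/-- The row of the word `x α_{i₁} ⋯ α_{iₖ}` with the given code. -/
def NCode.row (c : NCode) : List Letter := Sum.inl c.1 :: c.2.map fun j => Sum.inr (some j)

theorem Code.row_toN {n r : ℕ} (c : Code n r) : c.toN.row = (Word.descending c).row := by
  obtain ⟨i, Γ⟩ := c
  suffices H : ∀ w : Word n r, (Γ.foldl (fun w j => Word.alpha j w) w).row =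
      w.row ++ Γ.map fun j => Sum.inr (some j.val) by
    rw [Word.descending, H]
    simp [NCode.row, Code.toN, Word.row]
  induction Γ with
  | nil => intro w; simp
  | cons j Γ ih => intro w; rw [List.foldl_cons, ih]; simp [Word.row]

open Classical in
/-- The output of the search at its `N`-th stage: if `N` is the number of a valid certificate, the
rows of the words for the elements of the `A`-basis that the certificate describes. -/
noncomputable def searchStage (a : ℕ × ℕ × Rows) (N : ℕ) : Option (List (List Letter)) :=
  (Encodable.decode (α := Cert) N).bind fun z =>
    if Check a.1 a.2.1 a.2.2 z then some ((frontier a.1 a.2.1 z.2.1).map NCode.row) else none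

theorem primrec_searchStage : Primrec₂ searchStage := by
  classical
  open Primrec in
  change Primrec fun x : (ℕ × ℕ × Rows) × ℕ => searchStage x.1 x.2
  refine option_bind (Primrec.decode.comp snd) ?_
  change Primrec fun _ => _
  have ha : Primrec fun x : ((ℕ × ℕ × Rows) × ℕ) × Cert => x.1.1 := fst.comp fst
  refine Primrec.ite (primrecPred_check.comp (ha.pair snd)) (option_some.comp ?_) (const none)
  refine list_map (primrec_frontier (fst.comp ha) (fst.comp (snd.comp ha))
    (fst.comp (snd.comp snd))) ?_
  change Primrec fun _ => _
  exact list_cons.comp (sumInl.comp (fst.comp snd)) (list_map (snd.comp snd)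
    (sumInr.comp (option_some.comp snd)).to₂)

end Higman

theorem mainTheorem5 :
    (∀ n r : ℕ, 2 ≤ n → 1 ≤ r → ∀ ψ : Higman.G n r,
      ∃! X : Set (Higman.V n r), Higman.IsQuasiNormal ψ X) ∧
    ∃ f : ℕ × ℕ × List (List Higman.Letter × List Higman.Letter) →. List (List Higman.Letter),
      Partrec f ∧
      ∀ n r : ℕ, 2 ≤ n → 1 ≤ r →
        ∀ (ψ : Higman.G n r) (L : List (Higman.Word n r × Higman.Word n r)),
          Higman.Describes L ψ →
          ∃ B : List (Fin r × List (Fin n)), B.Nodup ∧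
            B.map (fun p => (Higman.Word.descending p).row) ∈ f (n, r, Higman.encodePairs L) ∧
            Higman.IsQuasiNormal ψ {v | ∃ p ∈ B, v = Higman.V.mk (Higman.Word.descending p)} := by
  refine ⟨fun n r hn _ ψ => Higman.existsUnique_isQuasiNormal (by omega) ψ,
    fun a => Nat.rfindOpt (Higman.searchStage a),
    Partrec.rfindOpt Higman.primrec_searchStage.to_comp, fun n r hn _ ψ L hL => ?_⟩
  have hn : 0 < n := by omega
  have hT := hL.table
  -- the search terminates
  obtain ⟨z₀, hz₀⟩ := hT.exists_check hn
  have hdom : (Nat.rfindOpt (Higman.searchStage (n, r, Higman.encodePairs L))).Dom := by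
    refine Nat.rfindOpt_dom.2 ⟨Encodable.encode z₀,
      (Higman.frontier n r z₀.2.1).map Higman.NCode.row, ?_⟩
    rw [Higman.searchStage, Encodable.encodek, Option.bind_some, if_pos hz₀]
    rfl
  obtain ⟨N, hN⟩ := Nat.rfindOpt_spec (Part.get_mem hdom)
  have hmem := Part.get_mem hdom
  -- whatever certificate is found first, it describes the quasi-normal form
  obtain ⟨z, -, hz⟩ := Option.bind_eq_some_iff.1 hN
  split_ifs at hz with hcheck
  obtain ⟨B', X, hB', hX, hs⟩ := hT.of_check hn hcheck
  obtain ⟨B, hB⟩ : ∃ B : List (Higman.Code n r), B.map Higman.Code.toN =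
      Higman.frontier n r z.2.1 := by
    have : Higman.frontier n r z.2.1 ∈
        Set.range (List.map (Higman.Code.toN (n := n) (r := r))) := by
      rw [Set.range_list_map]
      intro q hq
      rw [← hB'] at hq
      obtain ⟨c, hc, -⟩ := (hX.mem_frontier hn q).1 hq
      exact ⟨c, hc⟩
    exact this
  refine ⟨B, ?_, ?_, ?_⟩
  · refine List.Nodup.of_map Higman.Code.toN ?_
    rw [hB, ← hB']
    exact hX.nodup_frontier hn
  · rw [← Option.some.inj hz] at hmem
    convert hmem using 1
    rw [← hB, List.map_map]
    exact List.map_congr_left fun c _ => (Higman.Code.row_toN c).symm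
  · have hXB : {v | ∃ p ∈ B, v = Higman.V.mk (Higman.Word.descending p)} = X := by
      ext v
      constructor
      · rintro ⟨p, hp, rfl⟩
        have := List.mem_map_of_mem (f := Higman.Code.toN) hp
        rw [hB, ← hB', hX.mem_frontier hn] at this
        obtain ⟨c, hc, hcX⟩ := this
        rw [Higman.Code.toN_injective hc] at hcX
        exact hcX
      · intro hv
        obtain ⟨c, rfl⟩ := Higman.mem_ASpan_generators.1 ((hX.isABasis.isCut hn).subset hv)
        have := (hX.mem_frontier hn c.toN).2 ⟨c, rfl, hv⟩
        rw [hB', ← hB, List.mem_map_of_injective Higman.Code.toN_injective] at this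
        exact ⟨c, this, rfl⟩
    rw [hXB]
    exact hX.isQuasiNormal hn hs
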